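/- Let $I=[0,\infty)$ or $I=(0,\infty)$. A probability distribution $\mu$ on $\mathbb R$ is called geometrically infinitely divisible (g.i.d.) if for every $p\in(0,1)$ it is the law of $\sum_{j=1}^{N_p}X^{(p)}_j$, where $N_p,X^{(p)}_1,X^{(p)}_2,\dots$ are independent real random variables, the $X^{(p)}_j$ are identically distributed and $P\{N_p=n\}=p(1-p)^{n-1}$, $n=1,2,\dots$. The following four classes of probability distributions on $I$ are identical. (i) The g.i.d. distributions on $I$, together with the distributions on $I$ that are weak limits of sequences of such distributions. (ii) The distributions on $I$ whose characteristic function $g$ satisfies, for all $t\in\mathbb R$, $$g(t)=\lim_{n\to\infty}\frac{1}{1+\sum_{k=1}^{k_n}\lambda_{n,k}\left(1-e^{i\beta_{n,k}t}\right)}$$ for some nonnegative integers $k_n$, reals $\lambda_{n,k}>0$ and $\beta_{n,k}\in\mathbb R$. (iii) The distributions on $I$ that are weak limits, as $n\to\infty$, of the laws of $\sum_{j=1}^{N_n}X_{n,j}$, where $N_n$ has the geometric distribution on $\{1,2,\dots\}$ with mean $n$ and is independent of $(X_{n,j})_j$; for each $n\ge 1$ the $X_{n,j}$, $j\ge1$,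 are independent with a common distribution on $I$ whose Laplace transform is $e^{-\psi(s)/n}$, $s\ge 0$, for a real function $\psi$ not depending on $n$; and the $X_{n,j}$ are uniformly asymptotically negligible, that is, $\sup_jP\{|X_{n,j}|>\varepsilon\}\to0$ for every $\varepsilon>0$. (iv) The inter-arrival time distributions $G$ on $I$ of Cox and renewal processes. Here the ordinary renewal process with inter-arrival time distribution $G$ is called a Cox process if for every $p\in(0,1)$ there is a distribution $F_p$ on $I$ such that it is the $p$-thinning of the renewal process with inter-arrival time distribution $F_p$; the $p$-thinning retains each epoch $t_1,t_2,\dots$ with probability $p$ and deletes it with probability $1-p$, independently of the other epochs and of the process. -/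

import Mathlib

open MeasureTheory ProbabilityTheory Filter Topology

namespace GeomInfDiv

/-- `P{N = k} = p (1 - p)^(k - 1)` for `k = 1, 2, …`; for `0 < p ≤ 1` this is the geometric
distribution with mean `1 / p`. -/
def IsGeometric {Ω : Type} [MeasurableSpace Ω] (P : Measure Ω) (p : ℝ) (N : Ω → ℕ) : Prop :=
  Measurable N ∧ ∀ k : ℕ, P {ω | N ω = k + 1} = ENNReal.ofReal (p * (1 - p) ^ k)

/-- `μ` is the law of `X₁ + ⋯ + X_N`, where `N, X₁, X₂, …` are independent, the `X_j` have the
common law `ν` and `N` is geometric on `{1, 2, …}` with parameter `p`.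
(`X_{j+1}` is called `X j`.) -/
def IsGeomSum (p : ℝ) (ν μ : ProbabilityMeasure ℝ) : Prop :=
  ∃ (Ω : Type) (_ : MeasurableSpace Ω) (P : Measure Ω) (X : ℕ → Ω → ℝ) (N : Ω → ℕ),
    IsProbabilityMeasure P ∧
    (∀ j, Measurable (X j)) ∧
    (∀ j, HasLaw (X j) (ν : Measure ℝ) P) ∧
    iIndepFun X P ∧
    IsGeometric P p N ∧
    IndepFun N (fun ω j => X j ω) P ∧
    HasLaw (fun ω => ∑ j ∈ Finset.range (N ω), X j ω) (μ : Measure ℝ) P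

/-- Geometric infinite divisibility. -/
def IsGID (μ : ProbabilityMeasure ℝ) : Prop :=
  ∀ p : ℝ, 0 < p → p < 1 → ∃ ν : ProbabilityMeasure ℝ, IsGeomSum p ν μ

/-- The distribution `μ` is carried by the set `I`. -/
def CarriedBy (I : Set ℝ) (μ : ProbabilityMeasure ℝ) : Prop :=
  ∀ᵐ x ∂(μ : Measure ℝ), x ∈ I

/-- The distributions on `I` that are geometrically infinitely divisible, or are weak limits of
geometrically infinitely divisible distributions on `I`. -/
def gidClass (I : Set ℝ) : Set (ProbabilityMeasure ℝ) :=
  {μ | CarriedBy I μ ∧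
    (IsGID μ ∨ ∃ η : ℕ → ProbabilityMeasure ℝ,
      (∀ n, CarriedBy I (η n) ∧ IsGID (η n)) ∧ Tendsto η atTop (𝓝 μ))}

/-- The distributions on `I` whose characteristic function is a pointwise limit of functions
`1 / (1 + ∑_k λ_{n,k} (1 - exp (i β_{n,k} t)))` with finite sums and `λ_{n,k} > 0`. -/
def charFunLimitClass (I : Set ℝ) : Set (ProbabilityMeasure ℝ) :=
  {μ | CarriedBy I μ ∧
    ∃ (k : ℕ → ℕ) (l β : (n : ℕ) → Fin (k n) → ℝ),
      (∀ n j, 0 < l n j) ∧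
      ∀ t : ℝ, Tendsto
        (fun n => 1 / (1 + ∑ j, (l n j : ℂ) * (1 - Complex.exp (Complex.I * β n j * t))))
        atTop (𝓝 (charFun (μ : Measure ℝ) t))}

/-- The limit distributions on `I` of `X_{n,1} + ⋯ + X_{n,N_n}`, where `N_n` is geometric with
mean `n`, the summands of the `n`-th row have the common law `ν n` on `I` with Laplace transform
`exp (-ψ / n)`, and the summands are uniformly asymptotically negligible (in each row all the
summands have the same law, so the maximum over the row is attained by each of them). -/
def geomLimitClass (I : Set ℝ) : Set (ProbabilityMeasure ℝ) :=
  {μ | CarriedBy I μ ∧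
    ∃ (ψ : ℝ → ℝ) (ν η : ℕ → ProbabilityMeasure ℝ),
      (∀ n : ℕ, 1 ≤ n → CarriedBy I (ν n)) ∧
      (∀ n : ℕ, 1 ≤ n → ∀ s : ℝ, 0 ≤ s →
        ∫ x, Real.exp (-(s * x)) ∂(ν n : Measure ℝ) = Real.exp (-((1 / (n : ℝ)) * ψ s))) ∧
      (∀ ε : ℝ, 0 < ε →
        Tendsto (fun n => (ν n : Measure ℝ) {x | ε < |x|}) atTop (𝓝 0)) ∧
      (∀ n : ℕ, 1 ≤ n → IsGeomSum (1 / (n : ℝ)) (ν n) (η n)) ∧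
      Tendsto η atTop (𝓝 μ)}

/-- `0 = T 0, T 1, T 2, …` are the epochs of an ordinary renewal process with inter-arrival time
distribution `F`. -/
def IsRenewal {Ω : Type} [MeasurableSpace Ω] (P : Measure Ω) (F : ProbabilityMeasure ℝ)
    (T : ℕ → Ω → ℝ) : Prop :=
  (∀ ω, T 0 ω = 0) ∧
  (∀ n, HasLaw (fun ω => T (n + 1) ω - T n ω) (F : Measure ℝ) P) ∧
  iIndepFun (fun n ω => T (n + 1) ω - T n ω) P

/-- The epochs that remain when `T (n + 1)` is retained if `B n = true` and deleted otherwise;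
`T 0 = 0` is kept as the time origin.
(The value is arbitrary where only finitely many epochs are retained.) -/
noncomputable def retained {Ω : Type} (T : ℕ → Ω → ℝ) (B : ℕ → Ω → Bool) : ℕ → Ω → ℝ
  | 0, ω => T 0 ω
  | k + 1, ω => T (Nat.nth (fun n => B n ω = true) k + 1) ω

/-- The renewal process with inter-arrival time distribution `G` is the `p`-thinning of the renewal
process with inter-arrival time distribution `F`: every epoch is retained with probability `p`,
independently of the other epochs and of the process. -/
def IsThinning (p : ℝ) (F G : ProbabilityMeasure ℝ) : Prop :=
  ∃ (Ω : Type) (_ : MeasurableSpace Ω) (P : Measure Ω) (T : ℕ → Ω → ℝ) (B : ℕ → Ω → Bool),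
    IsProbabilityMeasure P ∧
    (∀ n, Measurable (T n)) ∧
    IsRenewal P F T ∧
    (∀ n, Measurable (B n)) ∧
    (∀ n, P {ω | B n ω = true} = ENNReal.ofReal p) ∧
    iIndepFun B P ∧
    IndepFun (fun ω n => B n ω) (fun ω n => T n ω) P ∧
    IsRenewal P G (retained T B)

/-- The inter-arrival time distributions on `I` of Cox and renewal processes: for every
`p ∈ (0, 1)` the renewal process is the `p`-thinning of a renewal process. -/
def coxRenewalClass (I : Set ℝ) : Set (ProbabilityMeasure ℝ) :=
  {G | CarriedBy I G ∧
    ∀ p : ℝ, 0 < p → p < 1 →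
      ∃ F : ProbabilityMeasure ℝ, CarriedBy I F ∧ IsThinning p F G}

end GeomInfDiv

/-! Let g be the characteristic function of a geometric sum with parameter p and h that of its
summands. Conditioning on the number of summands gives g (1 - (1 - p) h) = p h
(`IsGeomSum.charFun_mul`), which for nonzero g and h says 1/h - 1 = p (1/g - 1). Thus, with θ = 1/g
- 1, geometric infinite divisibility means that 1 / (1 + p θ) is a characteristic function for every
p in (0, 1).

If this holds and h belongs to the parameter p, then (1 - h) / p → θ as p → 0, so θ is a limit of
compound Poisson exponents (`tendsto_one_sub_charFun_div`); a doubling argument shows that g has no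
zeros. Conversely, if θ is a limit of c_n (1 - f_n) with characteristic functions f_n, then 1 / (1 +
p θ) is the limit of characteristic functions of geometric sums starting from 0, hence a
characteristic function by Lévy's theorem (`isGID_of_tendsto_inv`).

Discretising h turns the exponents into the finite sums of (ii). For (iii), exp(-θ/n) is the
transform of a law on I (`IsGID.exists_charFun_eq_exp`), and its geometric sum g_n of mean n
satisfies 1/g_n - 1 = n (exp(θ/n) - 1) → θ. For (iv), the first retained epoch of a thinning is a
geometric sum; the converse rests on an explicit thinned renewal process (`exists_isThinning`) and
uniqueness of characteristic functions. -/

namespace GeomInfDiv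

/-! ### Transforms and supports of geometric sums -/

/-- The transform `∫ exp (z x) μ(dx)`: the characteristic function for imaginary `z`, the Laplace
transform for real `z ≤ 0`. -/
noncomputable def expTransform (z : ℂ) (μ : Measure ℝ) : ℂ := ∫ x, Complex.exp (z * x) ∂μ

lemma expTransform_mul_I (t : ℝ) (μ : Measure ℝ) :
    expTransform (t * Complex.I) μ = charFun μ t := by
  rw [expTransform, charFun_apply_real]
  congr with x
  ring_nf

lemma norm_exp_mul_I_le_one (t x : ℝ) : ‖Complex.exp (t * Complex.I * x)‖ ≤ 1 := by
  rw [Complex.norm_exp]; simp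

lemma norm_expTransform_le_one {z : ℂ} {ν : ProbabilityMeasure ℝ}
    (hz : ∀ᵐ x : ℝ ∂(ν : Measure ℝ), ‖Complex.exp (z * x)‖ ≤ 1) :
    ‖expTransform z ν‖ ≤ 1 := by
  simpa [expTransform] using norm_integral_le_of_norm_le_const hz

lemma expTransform_sum_range {Ω : Type*} [MeasurableSpace Ω] {P : Measure Ω}
    [IsProbabilityMeasure P]
    {ν : Measure ℝ} {X : ℕ → Ω → ℝ} (hm : ∀ j, Measurable (X j)) (hl : ∀ j, HasLaw (X j) ν P)
    (hi : iIndepFun X P) (z : ℂ) (k : ℕ) :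
    ∫ ω, Complex.exp (z * ↑(∑ j ∈ Finset.range k, X j ω)) ∂P = expTransform z ν ^ k := by
  have h1 := (hi.precomp (Fin.val_injective (n := k))).integral_fun_prod_comp
    (f := fun _ x => Complex.exp (z * (x : ℝ))) (fun i => (hm i).aemeasurable)
    (fun i => by fun_prop)
  have h2 : ∀ j, ∫ ω, Complex.exp (z * (X j ω : ℝ)) ∂P = expTransform z ν := fun j => by
    rw [expTransform, ← (hl j).integral_comp (by fun_prop)]
    rfl
  simp only [h2, Finset.prod_const, Finset.card_univ, Fintype.card_fin] at h1
  rw [← h1]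
  congr with ω
  rw [← Complex.exp_sum, Fin.sum_univ_eq_sum_range (fun j => z * (X j ω : ℂ)), ← Finset.mul_sum]
  push_cast
  rfl

/-- `IsGeometric` prescribes only the masses at k + 1; these already add up to 1, which leaves no
mass at 0. -/
lemma hasSum_geometric_measureReal {Ω : Type} [MeasurableSpace Ω] {P : Measure Ω}
    [IsProbabilityMeasure P] {p : ℝ} (hp : 0 < p) (hp1 : p ≤ 1) {N : Ω → ℕ}
    (hN : IsGeometric P p N) :
    P.real {ω | N ω = 0} = 0 ∧ ∀ k, P.real {ω | N ω = k + 1} = p * (1 - p) ^ k := by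
  have h1 : ∀ k, P.real {ω | N ω = k + 1} = p * (1 - p) ^ k := fun k => by
    rw [measureReal_def, hN.2 k, ENNReal.toReal_ofReal]
    exact mul_nonneg hp.le (pow_nonneg (by linarith) _)
  refine ⟨?_, h1⟩
  have hmeas : ∀ k, MeasurableSet {ω | N ω = k} := fun k => hN.1 (measurableSet_singleton k)
  have h2 := hasSum_integral_iUnion (μ := P) (f := fun _ => (1 : ℝ)) (s := fun k => {ω | N ω = k})
    hmeas (fun i j hij => Set.disjoint_left.2 fun ω h h' => hij (h.symm.trans h'))
    (integrable_const _).integrableOn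
  have h3 : (⋃ k, {ω | N ω = k}) = Set.univ := by ext; simp
  simp only [integral_const, smul_eq_mul, mul_one, measureReal_restrict_apply_univ, h3,
    probReal_univ] at h2
  have h4 : HasSum (fun k => P.real {ω | N ω = k + 1}) 1 := by
    simp only [h1]
    have := (hasSum_geometric_of_lt_one (r := 1 - p) (by linarith) (by linarith)).mul_left p
    simpa [hp.ne'] using this
  have h5 := (hasSum_nat_add_iff' (f := fun k => P.real {ω | N ω = k}) 1).2 h2
  have := h5.unique h4
  simpa using this

/-- The transform of a geometric sum. -/
lemma IsGeomSum.expTransform_mul {p : ℝ} (hp : 0 < p) (hp1 : p ≤ 1) {ν μ : ProbabilityMeasure ℝ}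
    (h : IsGeomSum p ν μ) {z : ℂ} (hz : ∀ᵐ x : ℝ ∂(ν : Measure ℝ), ‖Complex.exp (z * x)‖ ≤ 1) :
    expTransform z μ * (1 - (1 - p) * expTransform z ν) = p * expTransform z ν := by
  obtain ⟨Ω, _, P, X, N, hP, hX, hl, hi, hN, hNX, hS⟩ := h
  have hmeas : ∀ k, MeasurableSet {ω | N ω = k} := fun k => hN.1 (measurableSet_singleton k)
  set a := expTransform z ν with ha
  have hXz : ∀ᵐ ω ∂P, ∀ j, ‖Complex.exp (z * (X j ω : ℝ))‖ ≤ 1 := by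
    refine ae_all_iff.2 fun j => ?_
    have := (hl j).map_eq ▸ hz
    exact ae_of_ae_map (hX j).aemeasurable this
  have hSmeas : Measurable fun ω => ∑ j ∈ Finset.range (N ω), X j ω := by
    have : Measurable fun q : ℕ × Ω => ∑ j ∈ Finset.range q.1, X j q.2 :=
      measurable_from_prod_countable_right fun n => by
        simpa using Finset.measurable_sum _ fun j _ => hX j
    exact this.comp (hN.1.prodMk measurable_id)
  have hInt : Integrable (fun ω => Complex.exp (z * ↑(∑ j ∈ Finset.range (N ω), X j ω))) P := by
    refine Integrable.of_bound (C := 1) (Complex.measurable_exp.comp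
      ((Complex.measurable_ofReal.comp hSmeas).const_mul z)).aestronglyMeasurable ?_
    filter_upwards [hXz] with ω hω
    push_cast
    rw [Finset.mul_sum, Complex.exp_sum, norm_prod]
    exact Finset.prod_le_one (fun _ _ => norm_nonneg _) fun j _ => hω j
  -- Decompose the expectation over the events N = k.
  have h2 := hasSum_integral_iUnion (μ := P)
    (f := fun ω => Complex.exp (z * ↑(∑ j ∈ Finset.range (N ω), X j ω)))
    (s := fun k => {ω | N ω = k})
    hmeas (fun i j hij => Set.disjoint_left.2 fun ω h h' => hij (h.symm.trans h'))
    hInt.integrableOn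
  have h3 : (⋃ k, {ω | N ω = k}) = Set.univ := by ext; simp
  have h4 : ∀ k, ∫ ω in {ω | N ω = k}, Complex.exp (z * ↑(∑ j ∈ Finset.range (N ω), X j ω)) ∂P
      = P.real {ω | N ω = k} * a ^ k := fun k => by
    rw [ha, ← expTransform_sum_range hX hl hi z k, ← integral_indicator (hmeas k)]
    -- On N = k the sum has a fixed number of terms, so the integrand factors into a function of N
    -- and a function of the sequence X.
    have := hNX.integral_fun_comp_mul_comp (f := ({k} : Set ℕ).indicator (fun _ => (1 : ℂ)))
      (g := fun y => Complex.exp (z * ↑(∑ j ∈ Finset.range k, y j))) hN.1.aemeasurable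
      (measurable_pi_lambda _ hX).aemeasurable
      (Measurable.aestronglyMeasurable (by fun_prop))
      (Measurable.aestronglyMeasurable (by fun_prop))
    have h5 : ∫ ω, ({k} : Set ℕ).indicator (fun _ => (1 : ℂ)) (N ω) ∂P
        = P.real {ω | N ω = k} := by
      rw [← integral_indicator_one (hmeas k), ← integral_complex_ofReal]
      congr with ω
      by_cases hk : N ω = k <;> simp [hk, Set.indicator]
    rw [← h5, ← this]
    congr with ω
    by_cases hk : N ω = k <;> simp [hk, Set.indicator]
  rw [h3, setIntegral_univ] at h2
  simp only [h4] at h2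
  have h6 : ∫ ω, Complex.exp (z * ↑(∑ j ∈ Finset.range (N ω), X j ω)) ∂P = expTransform z μ := by
    rw [expTransform, ← hS.integral_comp (by fun_prop)]
    rfl
  rw [h6, ← hasSum_nat_add_iff' 1] at h2
  obtain ⟨h0, h1⟩ := hasSum_geometric_measureReal hp hp1 hN
  have hna : ‖((1 - p : ℝ) : ℂ) * a‖ < 1 := by
    rw [norm_mul, Complex.norm_real, Real.norm_of_nonneg (by linarith)]
    have := norm_expTransform_le_one hz
    rw [← ha] at this
    nlinarith [norm_nonneg a]
  have h7 : HasSum (fun k : ℕ => (p * a) * (((1 - p : ℝ) : ℂ) * a) ^ k)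
      ((p * a) * (1 - ((1 - p : ℝ) : ℂ) * a)⁻¹) := (hasSum_geometric_of_norm_lt_one hna).mul_left _
  have h8 := h2.unique (h7.congr_fun fun k => by
    rw [h1, mul_pow]; push_cast; ring)
  have h9 : 1 - (1 - (p : ℂ)) * a ≠ 0 := fun h => by
    have : ((1 - p : ℝ) : ℂ) * a = 1 := by push_cast; linear_combination -h
    rw [this] at hna
    simp at hna
  simp only [Finset.range_one, Finset.sum_singleton, h0, Complex.ofReal_zero, zero_mul,
    sub_zero] at h8
  rw [h8]
  push_cast
  rw [mul_assoc, inv_mul_cancel₀ h9, mul_one]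

/-- The law of a geometric sum dominates `p` times the law of the summands. -/
lemma IsGeomSum.carriedBy {p : ℝ} (hp : 0 < p) {ν μ : ProbabilityMeasure ℝ}
    (h : IsGeomSum p ν μ) {I : Set ℝ} (hI : MeasurableSet I) (hμ : CarriedBy I μ) :
    CarriedBy I ν := by
  obtain ⟨Ω, _, P, X, N, hP, hX, hl, hi, hN, hNX, hS⟩ := h
  -- When N = 1 the sum is its first summand, so this product is the probability of an event on
  -- which the sum leaves I.
  have h1 : P {ω | X 0 ω ∉ I} * P {ω | N ω = 1} = 0 := by
    have h2 := hNX.measure_inter_preimage_eq_mul {1} {y | y 0 ∉ I} (measurableSet_singleton _)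
      (show MeasurableSet ((fun y : ℕ → ℝ => y 0) ⁻¹' Iᶜ) from measurable_pi_apply 0 hI.compl)
    rw [mul_comm]
    refine h2.symm.trans ?_
    have h3 : ∀ᵐ ω ∂P, ∑ j ∈ Finset.range (N ω), X j ω ∈ I :=
      ae_of_ae_map hS.aemeasurable (hS.map_eq ▸ hμ)
    refine measure_mono_null ?_ h3
    rintro ω ⟨hω1, hω2⟩ hω3
    simp only [Set.mem_preimage, Set.mem_singleton_iff, Set.mem_ofPred_eq] at hω1 hω2
    simp [hω1] at hω3
    exact hω2 hω3
  have h4 : P {ω | N ω = 1} ≠ 0 := by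
    have := hN.2 0
    simp at this
    rw [this]; simpa using hp
  have h5 : P {ω | X 0 ω ∉ I} = 0 := by simpa [h4] using h1
  have h6 := (hl 0).map_eq
  rw [CarriedBy, ← h6]
  exact (ae_map_iff (hX 0).aemeasurable hI).2 h5

/-! ### Success indices and independence along iterates -/

/-- The right-hand index satisfies q and is preceded by k + 1 successes: the first one and k after
it. `Nat.nth` inverts this count. -/
lemma nth_succ_eq_add_nth_shift {q : ℕ → Prop} (hq : (Set.ofPred q).Infinite) (k : ℕ) :
    Nat.nth q (k + 1) = Nat.nth q 0 + 1 + Nat.nth (fun i => q (Nat.nth q 0 + 1 + i)) k := by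
  classical
  set m := Nat.nth q 0 + 1 with hm
  have hinf : (Set.ofPred fun i => q (m + i)).Infinite := by
    refine Set.infinite_of_forall_exists_gt fun a => ?_
    obtain ⟨b, hb, hab⟩ := hq.exists_gt (m + a)
    refine ⟨b - m, ?_, by omega⟩
    change q (m + (b - m))
    rwa [Nat.add_sub_cancel' (by omega)]
  have h1 : q (m + Nat.nth (fun i => q (m + i)) k) := Nat.nth_mem_of_infinite hinf k
  have h2 : Nat.count q (m + Nat.nth (fun i => q (m + i)) k) = k + 1 := by
    rw [Nat.count_add, Nat.count_nth_of_infinite hinf, hm, Nat.count_nth_succ_of_infinite hq]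
    omega
  rw [← Nat.nth_count h1, h2]

lemma nth_zero_eq_iff_of_exists {q : ℕ → Prop} (hq : ∃ n, q n) (m : ℕ) :
    Nat.nth q 0 = m ↔ (∀ j < m, ¬ q j) ∧ q m := by
  classical
  rw [Nat.nth_zero_of_exists hq, Nat.find_eq_iff, and_comm]

/-- Subfamilies of an independent family indexed by disjoint sets are independent. -/
lemma indepFun_restrict_of_disjoint {Ω ι : Type*} {β : ι → Type*} [MeasurableSpace Ω]
    {P : Measure Ω} [IsProbabilityMeasure P] [∀ i, MeasurableSpace (β i)] {X : ∀ i, Ω → β i}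
    (hm : ∀ i, Measurable (X i)) (h : iIndepFun X P) {S T : Set ι} (hST : Disjoint S T) :
    IndepFun (fun ω (i : S) => X i ω) (fun ω (i : T) => X i ω) P := by
  classical
  refine IndepFun.process_indepFun_process (fun i => hm i) (fun j => hm j) fun I J => ?_
  have hd : Disjoint (I.map (Function.Embedding.subtype _))
      (J.map (Function.Embedding.subtype _)) := by
    rw [Finset.disjoint_left]
    intro a ha hb
    obtain ⟨x, -, rfl⟩ := Finset.mem_map.1 ha
    obtain ⟨y, -, hxy⟩ := Finset.mem_map.1 hb
    exact Set.disjoint_left.1 hST x.2 (by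
      have : (y : ι) = x := hxy
      exact this ▸ y.2)
  have := h.indepFun_finset _ _ hd hm
  refine this.comp (φ := fun y (i : I) => y ⟨i.1, Finset.mem_map_of_mem _ i.2⟩)
    (ψ := fun y (j : J) => y ⟨j.1, Finset.mem_map_of_mem _ j.2⟩) ?_ ?_ <;> fun_prop

/-- If `S` preserves `P` and `D` is independent of `S`, then `D, D ∘ S, D ∘ S ∘ S, …` are
independent. -/
lemma iIndepFun_iterate {Ω β : Type*} [MeasurableSpace Ω] [MeasurableSpace β] {P : Measure Ω}
    [IsProbabilityMeasure P] {D : Ω → β} {S : Ω → Ω} (hD : Measurable D)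
    (hS : MeasurePreserving S P P) (hDS : IndepFun D S P) :
    iIndepFun (fun k ω => D (S^[k] ω)) P := by
  classical
  -- Initial segments of indices suffice, since missing indices can carry the sure event. Induction
  -- splits off D and removes one S from the rest by invariance.
  have key : ∀ (n : ℕ) (A : ℕ → Set β), (∀ i, MeasurableSet (A i)) →
      P (⋂ i ∈ Finset.range n, (fun ω => D (S^[i] ω)) ⁻¹' A i)
        = ∏ i ∈ Finset.range n, P (D ⁻¹' A i) := by
    intro n
    induction n with
    | zero => intro A _; simp
    | succ n ih =>
      intro A hA
      have h1 : (⋂ i ∈ Finset.range (n + 1), (fun ω => D (S^[i] ω)) ⁻¹' A i)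
          = D ⁻¹' A 0 ∩ S ⁻¹' (⋂ i ∈ Finset.range n, (fun ω => D (S^[i] ω)) ⁻¹' A (i + 1)) := by
        ext ω
        simp only [Set.mem_iInter, Finset.mem_range, Set.mem_preimage, Set.mem_inter_iff]
        constructor
        · exact fun h => ⟨h 0 (by omega), fun i hi => h (i + 1) (by omega)⟩
        · rintro ⟨h0, h⟩ (_ | i) hi
          · exact h0
          · exact h i (by omega)
      have hmeas : MeasurableSet (⋂ i ∈ Finset.range n, (fun ω => D (S^[i] ω)) ⁻¹' A (i + 1)) :=
        Finset.measurableSet_biInter _ fun i _ =>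
          (hD.comp (hS.measurable.iterate i)) (hA (i + 1))
      rw [h1, hDS.measure_inter_preimage_eq_mul _ _ (hA 0) hmeas,
        hS.measure_preimage hmeas.nullMeasurableSet, ih _ fun i => hA (i + 1),
        Finset.prod_range_succ', mul_comm]
  rw [iIndepFun_iff_measure_inter_preimage_eq_mul]
  intro s A hA
  obtain ⟨n, hn⟩ := s.exists_nat_subset_range
  have h2 := key n (fun i => if i ∈ s then A i else Set.univ) (fun i => by
    by_cases hi : i ∈ s <;> simp [hi, hA])
  have h3 : (⋂ i ∈ Finset.range n, (fun ω => D (S^[i] ω)) ⁻¹' (if i ∈ s then A i else Set.univ))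
      = ⋂ i ∈ s, (fun ω => D (S^[i] ω)) ⁻¹' A i := by
    ext ω
    simp only [Set.mem_iInter, Set.mem_preimage]
    constructor
    · intro h i hi
      simpa [hi] using h i (hn hi)
    · intro h i _
      by_cases hi : i ∈ s
      · simpa [hi] using h i hi
      · simp [hi]
  rw [h3] at h2
  rw [h2, ← Finset.prod_subset hn (fun i _ hi => by simp [hi])]
  refine Finset.prod_congr rfl fun i hi => ?_
  have := (hS.iterate i).measure_preimage (hD (hA i hi)).nullMeasurableSet
  simp only [hi, if_true]
  exact this.symm

lemma measurable_nth_zero :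
    Measurable fun b : ℕ → Bool => Nat.nth (fun n => b n = true) 0 := by
  refine measurable_to_countable' fun m => ?_
  have h1 : MeasurableSet {b : ℕ → Bool | (∀ j < m, b j = false) ∧ b m = true} := by
    simp only [measurableSet_setOfPred]
    measurability
  -- Without any success `Nat.nth` has the default value 0, so the all-`false` sequence joins the
  -- preimage of 0.
  have h2 : MeasurableSet {b : ℕ → Bool | m = 0 ∧ ∀ n, b n = false} := by
    simp only [measurableSet_setOfPred]
    measurability
  convert! h1.union h2 using 1
  ext b
  simp only [Set.mem_preimage, Set.mem_singleton_iff, Set.mem_union, Set.mem_ofPred_eq]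
  by_cases hb : ∃ n, b n = true
  · have h3 : ¬ ∀ n, b n = false := by simpa using hb
    rw [nth_zero_eq_iff_of_exists hb]
    simp only [Bool.not_eq_true, h3, and_false, or_false]
  · have hb' : ∀ n, b n = false := by simpa using hb
    simp only [hb', Nat.nth_zero, Bool.false_eq_true, and_false, false_or, and_true,
      implies_true]
    have : (Set.ofPred fun _ : ℕ => False) = ∅ := rfl
    rw [this, Nat.sInf_empty, eq_comm]

/-! ### The first success in a Bernoulli sequence -/

section Bernoulli

variable {Ω : Type} [MeasurableSpace Ω] {P : Measure Ω} [IsProbabilityMeasure P]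
  {B : ℕ → Ω → Bool} {p : ℝ}

lemma measure_eq_false (hp : 0 ≤ p) (hB : ∀ n, Measurable (B n))
    (hBp : ∀ n, P {ω | B n ω = true} = ENNReal.ofReal p) (n : ℕ) :
    P {ω | B n ω = false} = ENNReal.ofReal (1 - p) := by
  have h1 : {ω | B n ω = false} = {ω | B n ω = true}ᶜ := by ext; simp
  rw [h1, prob_compl_eq_one_sub (s := {ω | B n ω = true})
      (hB n (measurableSet_singleton true)), hBp,
    ENNReal.ofReal_sub _ hp, ENNReal.ofReal_one]

lemma measure_forall_lt_eq_false (hp : 0 ≤ p) (hp1 : p ≤ 1) (hB : ∀ n, Measurable (B n))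
    (hBp : ∀ n, P {ω | B n ω = true} = ENNReal.ofReal p) (hi : iIndepFun B P) (m : ℕ) :
    P {ω | ∀ j < m, B j ω = false} = ENNReal.ofReal ((1 - p) ^ m) := by
  have h := hi.measure_inter_preimage_eq_mul (Finset.range m) (sets := fun _ => {false})
    (fun _ _ => measurableSet_singleton _)
  have h1 : (⋂ i ∈ Finset.range m, B i ⁻¹' {false}) = {ω | ∀ j < m, B j ω = false} := by
    ext; simp
  have h2 : ∀ i, P (B i ⁻¹' {false}) = ENNReal.ofReal (1 - p) := measure_eq_false hp hB hBp
  rw [h1] at h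
  rw [h, Finset.prod_congr rfl fun i _ => h2 i, Finset.prod_const, Finset.card_range,
    ENNReal.ofReal_pow (by linarith)]

/-- A first success at m is the difference of the events of m and of m + 1 initial failures. -/
lemma measure_first_true (hp : 0 ≤ p) (hp1 : p ≤ 1) (hB : ∀ n, Measurable (B n))
    (hBp : ∀ n, P {ω | B n ω = true} = ENNReal.ofReal p) (hi : iIndepFun B P) (m : ℕ) :
    P {ω | (∀ j < m, B j ω = false) ∧ B m ω = true} = ENNReal.ofReal (p * (1 - p) ^ m) := by
  have h1 : {ω | ∀ j < m, B j ω = false}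
      = {ω | ∀ j < m + 1, B j ω = false} ∪ {ω | (∀ j < m, B j ω = false) ∧ B m ω = true} := by
    ext ω
    simp only [Set.mem_ofPred_eq, Set.mem_union, Nat.forall_lt_succ_right]
    cases B m ω <;> simp
  have h2 : MeasurableSet {ω | (∀ j < m, B j ω = false) ∧ B m ω = true} := by
    simp only [measurableSet_setOfPred]
    measurability
  have h3 := congrArg P.real h1
  rw [measureReal_union (Set.disjoint_left.2 fun ω ha hb => by
    simpa [ha m (by omega)] using hb.2) h2] at h3
  simp only [measureReal_def, measure_forall_lt_eq_false hp hp1 hB hBp hi] at h3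
  rw [ENNReal.toReal_ofReal (pow_nonneg (sub_nonneg.2 hp1) _),
    ENNReal.toReal_ofReal (pow_nonneg (sub_nonneg.2 hp1) _)] at h3
  rw [← ENNReal.ofReal_toReal (measure_ne_top P {ω | (∀ j < m, B j ω = false) ∧ B m ω = true})]
  congr 1
  rw [pow_succ] at h3
  linarith

lemma ae_exists_true (hp : 0 < p) (hp1 : p ≤ 1) (hB : ∀ n, Measurable (B n))
    (hBp : ∀ n, P {ω | B n ω = true} = ENNReal.ofReal p) (hi : iIndepFun B P) :
    ∀ᵐ ω ∂P, ∃ n, B n ω = true := by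
  have h1 : Tendsto (fun m : ℕ => ENNReal.ofReal ((1 - p) ^ m)) atTop (𝓝 0) := by
    have := tendsto_pow_atTop_nhds_zero_of_lt_one (r := 1 - p) (by linarith) (by linarith)
    simpa using ENNReal.tendsto_ofReal this
  refine le_antisymm (ge_of_tendsto' h1 fun m => ?_) bot_le
  rw [← measure_forall_lt_eq_false hp.le hp1 hB hBp hi m]
  refine measure_mono fun ω hω j _ => ?_
  simp only [Set.mem_compl_iff, Set.mem_ofPred_eq, not_exists] at hω
  simpa using hω j

end Bernoulli

/-- A thinned renewal process has geometric sums as inter-arrival times. -/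
lemma IsThinning.isGeomSum {p : ℝ} (hp : 0 < p) (hp1 : p ≤ 1) {F G : ProbabilityMeasure ℝ}
    (h : IsThinning p F G) : IsGeomSum p F G := by
  obtain ⟨Ω, _, P, T, B, hP, hT, ⟨hT0, hTl, hTi⟩, hB, hBp, hBi, hBT, hG⟩ := h
  have hNm := measurable_nth_zero.add_const 1
  refine ⟨Ω, _, P, fun j ω => T (j + 1) ω - T j ω,
    fun ω => Nat.nth (fun n => B n ω = true) 0 + 1, hP, fun j => (hT _).sub (hT _), hTl, hTi,
    ⟨hNm.comp (measurable_pi_lambda _ hB), fun k => ?_⟩, ?_, ?_⟩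
  · rw [← measure_first_true hp.le hp1 hB hBp hBi k]
    -- The two events agree only where some epoch is retained, because of the default value of
    -- `Nat.nth`.
    refine measure_congr ?_
    filter_upwards [ae_exists_true hp hp1 hB hBp hBi] with ω hω
    apply propext
    change Nat.nth (fun n => B n ω = true) 0 + 1 = k + 1 ↔ (∀ j < k, B j ω = false) ∧ B k ω = true
    simp [nth_zero_eq_iff_of_exists hω]
  · exact hBT.comp (φ := fun b => Nat.nth (fun n => b n = true) 0 + 1)
      (ψ := fun t j => t (j + 1) - t j) hNm (by fun_prop)
  · have := hG.2.1 0
    convert! this using 2 with ω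
    rw [Finset.sum_range_sub (fun j => T j ω)]
    simp [retained]

/-! ### Construction of the thinned renewal process -/

/-- Configurations of a thinned renewal process: `ω (n, false)` is the `n`-th inter-arrival time
and `ω (n, true) = 1` means that the corresponding epoch is retained. -/
abbrev ThinningSpace : Type := ℕ × Bool → ℝ

namespace ThinningSpace

/-- The marking of the epochs. -/
noncomputable def mark (n : ℕ) (ω : ThinningSpace) : Bool := decide (ω (n, true) = 1)

/-- The epochs. -/
noncomputable def epoch (n : ℕ) (ω : ThinningSpace) : ℝ := ∑ j ∈ Finset.range n, ω (j, false)

/-- Drop the first `m` inter-arrival times and marks. -/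
def shift (m : ℕ) (ω : ThinningSpace) : ThinningSpace := fun i => ω (m + i.1, i.2)

/-- Replace the marks and inter-arrival times after the `m`-th epoch by `0`. -/
noncomputable def head (m : ℕ) (ω : ThinningSpace) : ThinningSpace :=
  fun i => if i.1 < m then ω i else 0

/-- The index of the first retained epoch, minus one. -/
noncomputable def firstIndex (ω : ThinningSpace) : ℕ := Nat.nth (fun n => mark n ω = true) 0

/-- The first retained epoch. -/
noncomputable def firstRetained (ω : ThinningSpace) : ℝ := epoch (firstIndex ω + 1) ω

/-- The configuration after the first retained epoch. -/
noncomputable def afterFirst (ω : ThinningSpace) : ThinningSpace := shift (firstIndex ω + 1) ω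

lemma measurable_decide_eq_one : Measurable fun x : ℝ => decide (x = 1) :=
  measurable_to_bool (by
    convert! measurableSet_singleton (1 : ℝ) using 1
    ext
    simp)

@[fun_prop]
lemma measurable_mark (n : ℕ) : Measurable (mark n) :=
  measurable_decide_eq_one.comp (measurable_pi_apply (n, true))

@[fun_prop]
lemma measurable_epoch (n : ℕ) : Measurable (epoch n) := by
  unfold epoch
  fun_prop

@[fun_prop]
lemma measurable_shift (m : ℕ) : Measurable (shift m) := by
  unfold shift
  fun_prop

lemma measurable_firstIndex : Measurable firstIndex :=
  measurable_nth_zero.comp (measurable_pi_lambda _ measurable_mark)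

lemma measurable_firstRetained : Measurable firstRetained := by
  have : Measurable fun q : ℕ × ThinningSpace => epoch (q.1 + 1) q.2 :=
    measurable_from_prod_countable_right fun n => measurable_epoch (n + 1)
  exact this.comp (measurable_firstIndex.prodMk measurable_id)

lemma measurable_afterFirst : Measurable afterFirst := by
  have : Measurable fun q : ℕ × ThinningSpace => shift (q.1 + 1) q.2 :=
    measurable_from_prod_countable_right fun n => measurable_shift (n + 1)
  exact this.comp (measurable_firstIndex.prodMk measurable_id)

/-- The law of the configuration: inter-arrival law `F`, marking law `β`. -/
noncomputable def law (F β : ProbabilityMeasure ℝ) : Measure ThinningSpace :=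
  Measure.infinitePi fun i => ((if i.2 then β else F : ProbabilityMeasure ℝ) : Measure ℝ)

instance (F β : ProbabilityMeasure ℝ) : IsProbabilityMeasure (law F β) := by
  unfold law
  infer_instance

variable {F β : ProbabilityMeasure ℝ}

lemma iIndepFun_eval : iIndepFun (fun (i : ℕ × Bool) (ω : ThinningSpace) => ω i) (law F β) :=
  iIndepFun_infinitePi (X := fun _ x => x) fun _ => measurable_id

lemma measurePreserving_shift (m : ℕ) : MeasurePreserving (shift m) (law F β) (law F β) := by
  refine ⟨measurable_shift m, ?_⟩
  exact Measure.map_infinitePi_infinitePi_of_inj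
    (P := fun i : ℕ × Bool => ((if i.2 then β else F : ProbabilityMeasure ℝ) : Measure ℝ))
    (f := fun i : ℕ × Bool => (m + i.1, i.2)) fun i j h => by
      simp only [Prod.mk.injEq, add_right_inj] at h
      exact Prod.ext h.1 h.2

lemma indepFun_head_shift (m : ℕ) : IndepFun (head m) (shift m) (law F β) := by
  have h := indepFun_restrict_of_disjoint (fun i => measurable_pi_apply i)
    (iIndepFun_eval (F := F) (β := β)) (S := {i | i.1 < m}) (T := {i | m ≤ i.1})
    (Set.disjoint_left.2 fun i (hi : i.1 < m) (hj : m ≤ i.1) => absurd hi (not_lt.2 hj))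
  refine h.comp (φ := fun y i => if hi : i.1 < m then y ⟨i, hi⟩ else 0)
    (ψ := fun y (i : ℕ × Bool) => y ⟨(m + i.1, i.2), Nat.le_add_right _ _⟩) ?_ (by fun_prop)
  refine measurable_pi_lambda _ fun i => ?_
  by_cases hi : i.1 < m
  · simp only [hi, dif_pos]; fun_prop
  · simp only [hi, dif_neg, not_false_eq_true]; fun_prop

lemma hasLaw_eval (i : ℕ × Bool) :
    HasLaw (fun ω : ThinningSpace => ω i)
      ((if i.2 then β else F : ProbabilityMeasure ℝ) : Measure ℝ) (law F β) :=
  (measurePreserving_eval_infinitePi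
    (fun i : ℕ × Bool => ((if i.2 then β else F : ProbabilityMeasure ℝ) : Measure ℝ)) i).hasLaw

lemma iIndepFun_mark : iIndepFun mark (law F β) :=
  (iIndepFun_eval.precomp (g := fun n : ℕ => (n, true)) fun a b h => by simpa using h).comp
    (fun _ x => decide (x = 1)) fun _ => measurable_decide_eq_one

lemma iIndepFun_increments : iIndepFun (fun n ω => epoch (n + 1) ω - epoch n ω) (law F β) := by
  have h := (iIndepFun_eval (F := F) (β := β)).precomp (g := fun n : ℕ => (n, false))
    fun a b h => by simpa using h
  convert! h using 3 with n ω
  simp [epoch, Finset.sum_range_succ]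

lemma isRenewal_epoch : IsRenewal (law F β) F epoch := by
  refine ⟨fun ω => by simp [epoch], fun n => ?_, iIndepFun_increments⟩
  convert! hasLaw_eval (F := F) (β := β) (n, false) using 2 with ω
  simp [epoch, Finset.sum_range_succ]

lemma indepFun_mark_epoch :
    IndepFun (fun ω n => mark n ω) (fun ω n => epoch n ω) (law F β) := by
  have h := indepFun_restrict_of_disjoint (fun i => measurable_pi_apply i)
    (iIndepFun_eval (F := F) (β := β)) (S := {i | i.2 = true}) (T := {i | i.2 = false})
    (Set.disjoint_left.2 fun i hi hj => by
      simp only [Set.mem_ofPred_eq] at hi hj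
      simp [hi] at hj)
  refine h.comp (φ := fun y n => decide (y ⟨(n, true), rfl⟩ = 1))
    (ψ := fun y n => ∑ j ∈ Finset.range n, y ⟨(j, false), rfl⟩) ?_ (by fun_prop)
  exact measurable_pi_lambda _ fun n =>
    measurable_decide_eq_one.comp (measurable_pi_apply _)

lemma measure_mark {p : ℝ} (hβ : (β : Measure ℝ) {1} = ENNReal.ofReal p) (n : ℕ) :
    law F β {ω | mark n ω = true} = ENNReal.ofReal p := by
  have h := (hasLaw_eval (F := F) (β := β) (n, true)).measure_eq (p := fun x => x = 1)
    (measurableSet_singleton 1)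
  simpa [mark, ← hβ] using h

lemma ae_exists_mark {p : ℝ} (hp : 0 < p) (hp1 : p ≤ 1)
    (hβ : (β : Measure ℝ) {1} = ENNReal.ofReal p) :
    ∀ᵐ ω ∂law F β, ∃ n, mark n ω = true :=
  ae_exists_true hp hp1 measurable_mark (measure_mark hβ) iIndepFun_mark

lemma ae_infinite_mark {p : ℝ} (hp : 0 < p) (hp1 : p ≤ 1)
    (hβ : (β : Measure ℝ) {1} = ENNReal.ofReal p) :
    ∀ᵐ ω ∂law F β, (Set.ofPred fun n => mark n ω = true).Infinite := by
  have h : ∀ᵐ ω ∂law F β, ∀ m, ∃ n, mark n (shift (m + 1) ω) = true :=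
    ae_all_iff.2 fun m => (measurePreserving_shift (m + 1)).quasiMeasurePreserving.ae
      (ae_exists_mark hp hp1 hβ)
  filter_upwards [h] with ω hω
  refine Set.infinite_of_forall_exists_gt fun m => ?_
  obtain ⟨n, hn⟩ := hω m
  exact ⟨m + 1 + n, hn, by omega⟩

/-- The regeneration property at the first retained epoch. The series need not be evaluated: E =
univ identifies it as the law of the first retained epoch, and A = univ then shows that `afterFirst`
preserves the law. -/
lemma measure_firstRetained_inter_afterFirst {p : ℝ} (hp : 0 < p) (hp1 : p ≤ 1)
    (hβ : (β : Measure ℝ) {1} = ENNReal.ofReal p)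
    {A : Set ℝ} (hA : MeasurableSet A)
    {E : Set ThinningSpace} (hE : MeasurableSet E) :
    law F β (firstRetained ⁻¹' A ∩ afterFirst ⁻¹' E)
      = (∑' m : ℕ, law F β {ω | ((∀ j < m, mark j ω = false) ∧ mark m ω = true) ∧
          epoch (m + 1) ω ∈ A}) * law F β E := by
  set C : ℕ → Set ThinningSpace := fun m => {ω | ((∀ j < m, mark j ω = false) ∧
    mark m ω = true) ∧ epoch (m + 1) ω ∈ A} with hC
  have hCm : ∀ m, MeasurableSet (C m) := fun m => by
    have h1 : MeasurableSet {ω | (∀ j < m, mark j ω = false) ∧ mark m ω = true} := by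
      simp only [measurableSet_setOfPred]
      measurability
    exact h1.inter (measurable_epoch (m + 1) hA)
  -- The event C m depends only on the first m + 1 inter-arrival times and marks, hence is
  -- independent of the configuration shifted by m + 1.
  have hCh : ∀ m, head (m + 1) ⁻¹' C m = C m := fun m => by
    have h1 : ∀ ω, ∀ j < m + 1, mark j (head (m + 1) ω) = mark j ω := fun ω j hj => by
      simp [mark, head, hj]
    have h2 : ∀ ω, epoch (m + 1) (head (m + 1) ω) = epoch (m + 1) ω := fun ω =>
      Finset.sum_congr rfl fun j hj => by simp [head, Finset.mem_range.1 hj]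
    ext ω
    simp only [hC, Set.mem_preimage, Set.mem_ofPred_eq, h2, h1 ω m (by omega)]
    refine and_congr_left fun _ => and_congr_left fun _ => forall₂_congr fun j hj => ?_
    rw [h1 ω j (by omega)]
  have h3 : (firstRetained ⁻¹' A ∩ afterFirst ⁻¹' E : Set ThinningSpace)
      =ᵐ[law F β] ⋃ m, (C m ∩ shift (m + 1) ⁻¹' E) := by
    filter_upwards [ae_exists_mark (F := F) hp hp1 hβ] with ω hω
    apply propext
    change (firstRetained ω ∈ A ∧ afterFirst ω ∈ E) ↔ ω ∈ ⋃ m, (C m ∩ shift (m + 1) ⁻¹' E)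
    have h4 : ∀ m, firstIndex ω = m ↔ (∀ j < m, mark j ω = false) ∧ mark m ω = true := fun m => by
      rw [firstIndex, nth_zero_eq_iff_of_exists hω]
      simp
    simp only [Set.mem_iUnion, Set.mem_inter_iff, hC, Set.mem_ofPred_eq, ← h4, Set.mem_preimage]
    constructor
    · exact fun h => ⟨_, ⟨rfl, h.1⟩, h.2⟩
    · rintro ⟨m, ⟨rfl, h⟩, h'⟩
      exact ⟨h, h'⟩
  have hd : Pairwise (Function.onFun Disjoint fun m => C m ∩ shift (m + 1) ⁻¹' E) := by
    intro m n hmn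
    refine Set.disjoint_left.2 fun ω h h' => ?_
    obtain ⟨⟨⟨h1, h2⟩, -⟩, -⟩ := h
    obtain ⟨⟨⟨h3, h4⟩, -⟩, -⟩ := h'
    rcases lt_or_gt_of_ne hmn with h | h
    · simp [h3 m h] at h2
    · simp [h1 n h] at h4
  rw [measure_congr h3, measure_iUnion hd fun m => (hCm m).inter (measurable_shift _ hE),
    ← ENNReal.tsum_mul_right]
  refine tsum_congr fun m => ?_
  have := (indepFun_head_shift (F := F) (β := β) (m + 1)).measure_inter_preimage_eq_mul _ _
    (hCm m) hE
  rwa [hCh, (measurePreserving_shift (m + 1)).measure_preimage hE.nullMeasurableSet] at this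

lemma measurePreserving_afterFirst {p : ℝ} (hp : 0 < p) (hp1 : p ≤ 1)
    (hβ : (β : Measure ℝ) {1} = ENNReal.ofReal p) :
    MeasurePreserving afterFirst (law F β) (law F β) := by
  refine ⟨measurable_afterFirst, Measure.ext fun E hE => ?_⟩
  have h1 := measure_firstRetained_inter_afterFirst (F := F) hp hp1 hβ MeasurableSet.univ hE
  -- Taking both sets to be everything shows that the series is 1.
  have h2 := measure_firstRetained_inter_afterFirst (F := F) hp hp1 hβ MeasurableSet.univ
    MeasurableSet.univ
  simp only [Set.preimage_univ, Set.univ_inter, measure_univ, mul_one] at h1 h2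
  rw [Measure.map_apply measurable_afterFirst hE, h1, ← h2, one_mul]

lemma indepFun_firstRetained_afterFirst {p : ℝ} (hp : 0 < p) (hp1 : p ≤ 1)
    (hβ : (β : Measure ℝ) {1} = ENNReal.ofReal p) :
    IndepFun firstRetained afterFirst (law F β) := by
  rw [indepFun_iff_measure_inter_preimage_eq_mul]
  intro A E hA hE
  have h1 := measure_firstRetained_inter_afterFirst (F := F) hp hp1 hβ hA MeasurableSet.univ
  simp only [Set.preimage_univ, Set.inter_univ, measure_univ, mul_one] at h1
  rw [measure_firstRetained_inter_afterFirst hp hp1 hβ hA hE, h1,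
    (measurePreserving_afterFirst hp hp1 hβ).measure_preimage hE.nullMeasurableSet]

lemma retained_succ {ω : ThinningSpace}
    (hω : (Set.ofPred fun n => mark n ω = true).Infinite) (k : ℕ) :
    retained epoch mark (k + 1) ω
      = firstRetained ω + retained epoch mark k (afterFirst ω) := by
  cases k with
  | zero => simp [retained, firstRetained, firstIndex, epoch]
  | succ k =>
    simp only [retained]
    rw [nth_succ_eq_add_nth_shift hω]
    change epoch (firstIndex ω + 1 + Nat.nth (fun i => mark i (afterFirst ω) = true) k + 1) ω = _
    rw [add_assoc, epoch, Finset.sum_range_add]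
    rfl

lemma infinite_mark_afterFirst {ω : ThinningSpace}
    (hω : (Set.ofPred fun n => mark n ω = true).Infinite) :
    (Set.ofPred fun n => mark n (afterFirst ω) = true).Infinite := by
  refine Set.infinite_of_forall_exists_gt fun a => ?_
  obtain ⟨b, hb, hab⟩ := hω.exists_gt (firstIndex ω + 1 + a)
  refine ⟨b - (firstIndex ω + 1), ?_, by omega⟩
  change mark (firstIndex ω + 1 + (b - (firstIndex ω + 1))) ω = true
  rwa [Nat.add_sub_cancel' (by omega)]

/-- This form of the increments makes `iIndepFun_iterate` applicable with D = `firstRetained` and S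
= `afterFirst`. -/
lemma retained_succ_sub (k : ℕ) {ω : ThinningSpace}
    (hω : (Set.ofPred fun n => mark n ω = true).Infinite) :
    retained epoch mark (k + 1) ω - retained epoch mark k ω
      = firstRetained (afterFirst^[k] ω) := by
  induction k generalizing ω with
  | zero => simp [retained, epoch, firstRetained, firstIndex]
  | succ k ih =>
    rw [retained_succ hω (k + 1), retained_succ hω k, add_sub_add_left_eq_sub,
      ih (infinite_mark_afterFirst hω)]
    rfl

lemma isRenewal_retained {p : ℝ} (hp : 0 < p) (hp1 : p ≤ 1)
    (hβ : (β : Measure ℝ) {1} = ENNReal.ofReal p)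
    {G : ProbabilityMeasure ℝ}
    (hG : (law F β).map firstRetained = (G : Measure ℝ)) :
    IsRenewal (law F β) G (retained epoch mark) := by
  have hae : ∀ k, (fun ω => retained epoch mark (k + 1) ω - retained epoch mark k ω)
      =ᵐ[law F β] fun ω => firstRetained (afterFirst^[k] ω) := fun k => by
    filter_upwards [ae_infinite_mark hp hp1 hβ] with ω hω using retained_succ_sub k hω
  have hS := measurePreserving_afterFirst (F := F) hp hp1 hβ
  refine ⟨fun ω => by simp [retained, epoch], fun k => ?_, ?_⟩
  · refine HasLaw.congr ?_ (hae k)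
    have h1 : HasLaw firstRetained (G : Measure ℝ) (law F β) :=
      ⟨measurable_firstRetained.aemeasurable, hG⟩
    exact h1.comp (hS.iterate k).hasLaw
  · exact (iIndepFun_congr hae).2 (iIndepFun_iterate measurable_firstRetained hS
      (indepFun_firstRetained_afterFirst hp hp1 hβ))

end ThinningSpace

/-- Every renewal process can be thinned, and the result is a renewal process. -/
lemma exists_isThinning {p : ℝ} (hp : 0 < p) (hp1 : p ≤ 1) (F : ProbabilityMeasure ℝ) :
    ∃ G, IsThinning p F G := by
  -- The marks are coded as the reals 0 and 1, so that one product of real lines carries marks and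
  -- inter-arrival times.
  let b : Measure ℝ := ENNReal.ofReal p • Measure.dirac 1 + ENNReal.ofReal (1 - p) • Measure.dirac 0
  have hb : IsProbabilityMeasure b := ⟨by
    simp [b, ← ENNReal.ofReal_add hp.le (sub_nonneg.2 hp1)]⟩
  let β : ProbabilityMeasure ℝ := ⟨b, hb⟩
  have hβ : (β : Measure ℝ) {1} = ENNReal.ofReal p := by
    simp [β, b]
  have hG : IsProbabilityMeasure ((ThinningSpace.law F β).map ThinningSpace.firstRetained) :=
    Measure.isProbabilityMeasure_map ThinningSpace.measurable_firstRetained.aemeasurable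
  exact ⟨⟨_, hG⟩, ThinningSpace, _, ThinningSpace.law F β, ThinningSpace.epoch,
    ThinningSpace.mark, inferInstance, ThinningSpace.measurable_epoch,
    ThinningSpace.isRenewal_epoch, ThinningSpace.measurable_mark, ThinningSpace.measure_mark hβ,
    ThinningSpace.iIndepFun_mark, ThinningSpace.indepFun_mark_epoch,
    ThinningSpace.isRenewal_retained hp hp1 hβ rfl⟩

/-! ### Lévy continuity and the functional equation of geometric sums -/

/-- Lévy's continuity theorem: a pointwise limit of characteristic functions that is continuous
at `0` is the characteristic function of the weak limit. -/
lemma exists_tendsto_of_tendsto_charFun {μ : ℕ → ProbabilityMeasure ℝ} {f : ℝ → ℂ}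
    (hf : ContinuousAt f 0)
    (h : ∀ t, Tendsto (fun n => charFun (μ n : Measure ℝ) t) atTop (𝓝 (f t))) :
    ∃ μ₀ : ProbabilityMeasure ℝ, (∀ t, charFun (μ₀ : Measure ℝ) t = f t) ∧
      Tendsto μ atTop (𝓝 μ₀) := by
  have h_tight : IsTightMeasureSet (Set.range fun n => (μ n : Measure ℝ)) :=
    isTightMeasureSet_of_tendsto_charFun hf h
  have h_compact : IsCompact (closure (Set.range μ)) :=
    isCompact_closure_of_isTightMeasureSet (by
      convert! h_tight using 1
      ext
      simp)
  -- Tightness yields a limit along an ultrafilter; this already identifies its characteristic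
  -- function as f, and then the whole sequence converges.
  obtain ⟨μ₀, -, hμ₀ : Tendsto _ _ _⟩ := h_compact.ultrafilter_le_nhds
    ((hyperfilter ℕ).map μ) (le_principal_iff.2 (mem_of_superset (range_mem_map (m := μ))
      subset_closure))
  have heq : ∀ t, charFun (μ₀ : Measure ℝ) t = f t := fun t => by
    refine tendsto_nhds_unique ?_ ((h t).mono_left Nat.hyperfilter_le_atTop)
    rw [ProbabilityMeasure.tendsto_iff_forall_integral_rclike_tendsto ℂ] at hμ₀
    simp_rw [charFun_eq_integral_innerProbChar]
    exact hμ₀ (BoundedContinuousFunction.innerProbChar t)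
  refine ⟨μ₀, heq, ProbabilityMeasure.tendsto_of_tendsto_charFun fun t => ?_⟩
  rw [heq]
  exact h t

lemma eq_of_charFun_eq {μ ν : ProbabilityMeasure ℝ}
    (h : ∀ t, charFun (μ : Measure ℝ) t = charFun (ν : Measure ℝ) t) : μ = ν := by
  have : (μ : Measure ℝ) = ν := Measure.ext_of_charFun (funext h)
  exact Subtype.ext this

lemma one_sub_mul_ne_zero {p : ℝ} (hp : 0 < p) (hp1 : p ≤ 1) {a : ℂ} (ha : ‖a‖ ≤ 1) :
    1 - (1 - (p : ℂ)) * a ≠ 0 := fun h => by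
  have h1 : ((1 - p : ℝ) : ℂ) * a = 1 := by push_cast; linear_combination -h
  have h2 := congrArg norm h1
  rw [norm_mul, Complex.norm_real, Real.norm_of_nonneg (by linarith), norm_one] at h2
  nlinarith [norm_nonneg a]

lemma IsGeomSum.charFun_mul {p : ℝ} (hp : 0 < p) (hp1 : p ≤ 1) {ν μ : ProbabilityMeasure ℝ}
    (h : IsGeomSum p ν μ) (t : ℝ) :
    charFun (μ : Measure ℝ) t * (1 - (1 - p) * charFun (ν : Measure ℝ) t)
      = p * charFun (ν : Measure ℝ) t := by
  simpa only [expTransform_mul_I] using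
    h.expTransform_mul hp hp1 (z := t * Complex.I) (ae_of_all _ (norm_exp_mul_I_le_one t))

/-- The relation between the characteristic functions characterizes the thinnings. -/
lemma isThinning_of_charFun_mul {p : ℝ} (hp : 0 < p) (hp1 : p ≤ 1) {ν μ : ProbabilityMeasure ℝ}
    (h : ∀ t, charFun (μ : Measure ℝ) t * (1 - (1 - p) * charFun (ν : Measure ℝ) t)
      = p * charFun (ν : Measure ℝ) t) : IsThinning p ν μ := by
  obtain ⟨G, hG⟩ := exists_isThinning hp hp1 ν
  have : G = μ := eq_of_charFun_eq fun t =>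
    mul_right_cancel₀ (one_sub_mul_ne_zero hp hp1 (norm_charFun_le_one t))
      (((hG.isGeomSum hp hp1).charFun_mul hp hp1 t).trans (h t).symm)
  exact this ▸ hG

lemma IsGeomSum.isThinning {p : ℝ} (hp : 0 < p) (hp1 : p ≤ 1) {ν μ : ProbabilityMeasure ℝ}
    (h : IsGeomSum p ν μ) : IsThinning p ν μ :=
  isThinning_of_charFun_mul hp hp1 (h.charFun_mul hp hp1)

lemma exists_isGeomSum {p : ℝ} (hp : 0 < p) (hp1 : p ≤ 1) (ν : ProbabilityMeasure ℝ) :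
    ∃ μ, IsGeomSum p ν μ :=
  (exists_isThinning hp hp1 ν).imp fun _ h => h.isGeomSum hp hp1

/-- This is the denominator when the relation is solved for the summands: h = g / (p + (1 - p) g).
-/
lemma add_one_sub_mul_ne_zero {p : ℝ} (hp : 0 < p) (hp1 : p ≤ 1) {a : ℂ} (ha : 0 ≤ a.re) :
    (p : ℂ) + (1 - p) * a ≠ 0 := fun h => by
  have h1 := congrArg Complex.re h
  have h2 : ((1 : ℂ) - p) = ((1 - p : ℝ) : ℂ) := by push_cast; rfl
  rw [h2] at h1
  simp only [Complex.add_re, Complex.ofReal_re, Complex.re_ofReal_mul, Complex.zero_re] at h1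
  nlinarith [mul_nonneg (sub_nonneg.2 hp1) ha]

/-- Being a geometric sum is preserved under limits of characteristic functions, as long as the
limit has nonnegative real part. -/
lemma exists_isGeomSum_of_tendsto {p : ℝ} (hp : 0 < p) (hp1 : p ≤ 1) {μ : ProbabilityMeasure ℝ}
    {ν : ℕ → ProbabilityMeasure ℝ} {g : ℕ → ℝ → ℂ}
    (hg : ∀ n t, charFun (ν n : Measure ℝ) t * (p + (1 - p) * g n t) = g n t)
    (hlim : ∀ t, Tendsto (fun n => g n t) atTop (𝓝 (charFun (μ : Measure ℝ) t)))
    (hre : ∀ t, 0 ≤ (charFun (μ : Measure ℝ) t).re) :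
    ∃ ν₀, IsGeomSum p ν₀ μ := by
  have hne : ∀ t, (p : ℂ) + (1 - p) * charFun (μ : Measure ℝ) t ≠ 0 := fun t =>
    add_one_sub_mul_ne_zero hp hp1 (hre t)
  have hden : ∀ t, Tendsto (fun n => (p : ℂ) + (1 - p) * g n t) atTop
      (𝓝 ((p : ℂ) + (1 - p) * charFun (μ : Measure ℝ) t)) := fun t =>
    ((hlim t).const_mul _).const_add _
  have hcont : Continuous (charFun (μ : Measure ℝ)) := continuous_charFun
  -- The limit is the relation solved for the summands; it inherits continuity from the
  -- characteristic function of μ.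
  obtain ⟨ν₀, hν₀, -⟩ := exists_tendsto_of_tendsto_charFun (μ := ν)
    (f := fun t => charFun (μ : Measure ℝ) t / (p + (1 - p) * charFun (μ : Measure ℝ) t))
    (hcont.div (by fun_prop) hne).continuousAt fun t => by
      refine ((hlim t).div (hden t) (hne t)).congr' ?_
      filter_upwards [(hden t).eventually_ne (hne t)] with n hn
      exact (eq_div_of_mul_eq hn (hg n t)).symm
  refine ⟨ν₀, (isThinning_of_charFun_mul hp hp1 fun t => ?_).isGeomSum hp hp1⟩
  rw [hν₀ t]
  rw [← mul_div_assoc, ← mul_div_assoc, one_sub_div (hne t), ← mul_div_assoc]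
  congr 1
  ring

/-! ### Small parameters and absence of zeros -/

lemma re_charFun_le_one (ν : ProbabilityMeasure ℝ) (t : ℝ) :
    (charFun (ν : Measure ℝ) t).re ≤ 1 :=
  (Complex.re_le_norm _).trans (norm_charFun_le_one t)

lemma re_charFun (ν : ProbabilityMeasure ℝ) (t : ℝ) :
    (charFun (ν : Measure ℝ) t).re = ∫ x, Real.cos (t * x) ∂(ν : Measure ℝ) := by
  have hInt : Integrable (fun x : ℝ => Complex.exp (t * x * Complex.I)) (ν : Measure ℝ) :=
    Integrable.of_bound (C := 1) (by fun_prop) (ae_of_all _ fun x => by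
      rw [Complex.norm_exp]; simp)
  rw [charFun_apply_real, ← RCLike.re_eq_complex_re, ← integral_re hInt]
  congr with x
  simp [Complex.exp_re]

/-- Integrate 1 - cos 2u ≤ 4 (1 - cos u), whose two sides differ by 2 (1 - cos u)². -/
lemma one_sub_re_charFun_two_mul_le (ν : ProbabilityMeasure ℝ) (t : ℝ) :
    1 - (charFun (ν : Measure ℝ) (2 * t)).re ≤ 4 * (1 - (charFun (ν : Measure ℝ) t).re) := by
  have hInt : ∀ s : ℝ, Integrable (fun x : ℝ => Real.cos (s * x)) (ν : Measure ℝ) := fun s =>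
    Integrable.of_bound (C := 1) (by fun_prop) (ae_of_all _ fun x => Real.abs_cos_le_one _)
  have h1 : ∀ s : ℝ, 1 - (charFun (ν : Measure ℝ) s).re
      = ∫ x, (1 - Real.cos (s * x)) ∂(ν : Measure ℝ) := fun s => by
    rw [integral_sub (integrable_const _) (hInt s), re_charFun]
    simp
  rw [h1, h1, ← integral_const_mul]
  refine integral_mono ((integrable_const _).sub (hInt _))
    (((integrable_const _).sub (hInt _)).const_mul _) fun x => ?_
  change 1 - Real.cos (2 * t * x) ≤ 4 * (1 - Real.cos (t * x))
  rw [mul_assoc, Real.cos_two_mul]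
  nlinarith [sq_nonneg (1 - Real.cos (t * x))]

/-- If `g = p h / (1 - (1 - p) h)` with fixed `g` and `p → 0`, then `(1 - h) / p → 1 / g - 1`. -/
lemma tendsto_one_sub_div {p : ℕ → ℝ} (hp : ∀ n, 0 < p n) (hp0 : Tendsto p atTop (𝓝 0)) {g : ℂ}
    {h : ℕ → ℂ} (hg : g ≠ 0) (hgh : ∀ n, g * (1 - (1 - p n) * h n) = p n * h n) :
    Tendsto (fun n => (1 - h n) / p n) atTop (𝓝 (1 / g - 1)) := by
  have hp0' : Tendsto (fun n => (p n : ℂ)) atTop (𝓝 0) :=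
    (Complex.continuous_ofReal.tendsto 0).comp hp0
  have hd : ∀ n, (p n : ℂ) + (1 - p n) * g ≠ 0 := fun n h0 =>
    hg (by linear_combination hgh n + h n * h0)
  -- Solving the relation gives (1 - h) / p = (1 - g) / (p + (1 - p) g), with a nonvanishing limit
  -- of the denominator.
  have h2 : Tendsto (fun n => (1 - g) / ((p n : ℂ) + (1 - p n) * g)) atTop (𝓝 (1 / g - 1)) := by
    have h3 : Tendsto (fun n => (p n : ℂ) + (1 - p n) * g) atTop (𝓝 (0 + (1 - 0) * g)) :=
      hp0'.add ((hp0'.const_sub 1).mul_const g)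
    have h4 := (tendsto_const_nhds (x := 1 - g)).div h3 (by simpa using hg)
    rwa [zero_add, sub_zero, one_mul, sub_div, div_self hg] at h4
  refine h2.congr fun n => ?_
  have hpn : (p n : ℂ) ≠ 0 := by exact_mod_cast (hp n).ne'
  rw [div_eq_div_iff (hd n) hpn]
  linear_combination -hgh n

/-- If the geometric sums of the `ν n` with vanishing parameters `p n` all have the law `μ`, then
`charFun μ` is given by the rescaled characteristic functions of the summands. -/
lemma tendsto_one_sub_charFun_div {p : ℕ → ℝ} (hp : ∀ n, 0 < p n) (hp1 : ∀ n, p n ≤ 1)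
    (hp0 : Tendsto p atTop (𝓝 0)) {μ : ProbabilityMeasure ℝ} {ν : ℕ → ProbabilityMeasure ℝ}
    (h : ∀ n, IsGeomSum (p n) (ν n) μ) {t : ℝ} (ht : charFun (μ : Measure ℝ) t ≠ 0) :
    Tendsto (fun n => (1 - charFun (ν n : Measure ℝ) t) / p n) atTop
      (𝓝 (1 / charFun (μ : Measure ℝ) t - 1)) :=
  tendsto_one_sub_div hp hp0 ht fun n => (h n).charFun_mul (hp n) (hp1 n) t

lemma tendsto_charFun_of_tendsto_div {p : ℕ → ℝ} (hp : ∀ n, 0 < p n)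
    (hp0 : Tendsto p atTop (𝓝 0)) {ν : ℕ → ProbabilityMeasure ℝ} {t : ℝ} {c : ℂ}
    (h : Tendsto (fun n => (1 - charFun (ν n : Measure ℝ) t) / p n) atTop (𝓝 c)) :
    Tendsto (fun n => charFun (ν n : Measure ℝ) t) atTop (𝓝 1) := by
  have hp0' : Tendsto (fun n => (p n : ℂ)) atTop (𝓝 0) :=
    (Complex.continuous_ofReal.tendsto 0).comp hp0
  have h1 := (h.mul hp0').const_sub 1
  rw [mul_zero, sub_zero] at h1
  refine h1.congr fun n => ?_
  have hpn : (p n : ℂ) ≠ 0 := by exact_mod_cast (hp n).ne'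
  rw [div_mul_cancel₀ _ hpn, sub_sub_cancel]

/-- Wherever g is nonzero, the summands' characteristic functions tend to 1. A zero of g at 2s would
make them vanish there, contradicting the doubling inequality if g(s) ≠ 0. Since g is nonzero near
0, repeated doubling reaches every t. -/
lemma charFun_ne_zero_of_isGeomSum {p : ℕ → ℝ} (hp : ∀ n, 0 < p n) (hp1 : ∀ n, p n ≤ 1)
    (hp0 : Tendsto p atTop (𝓝 0)) {μ : ProbabilityMeasure ℝ} {ν : ℕ → ProbabilityMeasure ℝ}
    (h : ∀ n, IsGeomSum (p n) (ν n) μ) (t : ℝ) : charFun (μ : Measure ℝ) t ≠ 0 := by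
  have hcont : Continuous (charFun (μ : Measure ℝ)) := continuous_charFun
  have hev : ∀ᶠ s in 𝓝 (0 : ℝ), charFun (μ : Measure ℝ) s ≠ 0 :=
    hcont.continuousAt.eventually_ne (by simp)
  have hre : ∀ {s : ℝ}, charFun (μ : Measure ℝ) s ≠ 0 →
      Tendsto (fun n => (charFun (ν n : Measure ℝ) s).re) atTop (𝓝 1) := fun hs => by
    have := tendsto_charFun_of_tendsto_div hp hp0 (tendsto_one_sub_charFun_div hp hp1 hp0 h hs)
    exact Complex.one_re ▸ (Complex.continuous_re.tendsto _).comp this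
  have hdouble : ∀ s, charFun (μ : Measure ℝ) s ≠ 0 → charFun (μ : Measure ℝ) (2 * s) ≠ 0 := by
    intro s hs h0
    have h1 : ∀ n, charFun (ν n : Measure ℝ) (2 * s) = 0 := fun n => by
      have := (h n).charFun_mul (hp n) (hp1 n) (2 * s)
      rw [h0, zero_mul, eq_comm, mul_eq_zero] at this
      exact this.resolve_left (by exact_mod_cast (hp n).ne')
    have h2 := ((hre hs).const_sub 1).const_mul 4
    have h3 : (1 : ℝ) ≤ 4 * (1 - 1) := ge_of_tendsto' h2 fun n => by
      have := one_sub_re_charFun_two_mul_le (ν n) s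
      rwa [h1 n, Complex.zero_re, sub_zero] at this
    norm_num at h3
  have hpow : ∀ (k : ℕ) (s : ℝ), charFun (μ : Measure ℝ) s ≠ 0 →
      charFun (μ : Measure ℝ) (2 ^ k * s) ≠ 0 := by
    intro k
    induction k with
    | zero => intro s hs; simpa using hs
    | succ k ih =>
      intro s hs
      rw [pow_succ', mul_assoc]
      exact hdouble _ (ih s hs)
  have hlim : Tendsto (fun k : ℕ => t / 2 ^ k) atTop (𝓝 0) :=
    tendsto_const_nhds.div_atTop (tendsto_pow_atTop_atTop_of_one_lt one_lt_two)
  obtain ⟨k, hk⟩ := (hlim.eventually hev).exists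
  have := hpow k _ hk
  rwa [mul_div_cancel₀ _ (by positivity)] at this

lemma re_nonneg_of_one_le_re_inv {w : ℂ} (h : 0 ≤ (1 / w - 1).re) : 0 ≤ w.re := by
  have h1 : 1 ≤ w⁻¹.re := by
    simp only [one_div, Complex.sub_re, Complex.one_re] at h
    linarith
  rw [Complex.inv_re] at h1
  by_contra hw
  have : w.re / Complex.normSq w ≤ 0 :=
    div_nonpos_of_nonpos_of_nonneg (not_le.1 hw).le (Complex.normSq_nonneg _)
  linarith

/-- A sequence of parameters in `(0, 1)` tending to `0`. -/
lemma parameter_seq : (∀ n : ℕ, (0 : ℝ) < 1 / ((n : ℝ) + 2)) ∧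
    (∀ n : ℕ, 1 / ((n : ℝ) + 2) < 1) ∧
    Tendsto (fun n : ℕ => 1 / ((n : ℝ) + 2)) atTop (𝓝 0) := by
  refine ⟨fun n => by positivity, fun n => ?_, ?_⟩
  · rw [div_lt_one (by positivity)]
    have : (0 : ℝ) ≤ n := n.cast_nonneg
    linarith
  · exact tendsto_const_nhds.div_atTop
      (tendsto_atTop_add_const_right _ _ tendsto_natCast_atTop_atTop)

lemma IsGID.charFun_ne_zero {μ : ProbabilityMeasure ℝ} (h : IsGID μ) (t : ℝ) :
    charFun (μ : Measure ℝ) t ≠ 0 := by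
  obtain ⟨h0, h1, h2⟩ := parameter_seq
  choose ν hν using fun n : ℕ => h _ (h0 n) (h1 n)
  exact charFun_ne_zero_of_isGeomSum h0 (fun n => (h1 n).le) h2 hν t

/-- The limit 1/g - 1 of (1 - h_n) / p_n has nonnegative real part, and g and 1/g have real parts of
the same sign. -/
lemma IsGID.re_charFun_nonneg {μ : ProbabilityMeasure ℝ} (h : IsGID μ) (t : ℝ) :
    0 ≤ (charFun (μ : Measure ℝ) t).re := by
  obtain ⟨h0, h1, h2⟩ := parameter_seq
  choose ν hν using fun n : ℕ => h _ (h0 n) (h1 n)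
  have h3 := tendsto_one_sub_charFun_div h0 (fun n => (h1 n).le) h2 hν (h.charFun_ne_zero t)
  refine re_nonneg_of_one_le_re_inv (ge_of_tendsto' ((Complex.continuous_re.tendsto _).comp h3)
    fun n => ?_)
  rw [Function.comp_apply, Complex.div_ofReal_re, Complex.sub_re, Complex.one_re]
  exact div_nonneg (sub_nonneg.2 (re_charFun_le_one _ _)) (h0 n).le

/-! ### Closure under weak limits; Cox and renewal processes -/

/-- Geometric infinite divisibility is preserved under weak limits. -/
lemma isGID_of_tendsto {η : ℕ → ProbabilityMeasure ℝ} {μ : ProbabilityMeasure ℝ}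
    (h : ∀ n, IsGID (η n)) (hlim : Tendsto η atTop (𝓝 μ)) : IsGID μ := by
  intro p hp hp1
  choose ν hν using fun n => h n p hp hp1
  rw [ProbabilityMeasure.tendsto_iff_tendsto_charFun] at hlim
  refine exists_isGeomSum_of_tendsto hp hp1.le (ν := ν)
    (g := fun n t => charFun (η n : Measure ℝ) t) (fun n t => ?_) hlim fun t => ?_
  · linear_combination -(hν n).charFun_mul hp hp1.le t
  · exact ge_of_tendsto' ((Complex.continuous_re.tendsto _).comp (hlim t)) fun n =>
      (h n).re_charFun_nonneg t

/-- By closedness, the weak limits in the definition add nothing. -/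
lemma mem_gidClass_iff {I : Set ℝ} {μ : ProbabilityMeasure ℝ} :
    μ ∈ gidClass I ↔ CarriedBy I μ ∧ IsGID μ := by
  refine and_congr_right fun _ => ⟨?_, Or.inl⟩
  rintro (h | ⟨η, hη, hlim⟩)
  · exact h
  · exact isGID_of_tendsto (fun n => (hη n).2) hlim

/-- The geometrically infinitely divisible distributions are the inter-arrival time distributions
of Cox and renewal processes. -/
lemma gidClass_eq_coxRenewalClass {I : Set ℝ} (hI : MeasurableSet I) :
    gidClass I = coxRenewalClass I := by
  ext μ
  rw [mem_gidClass_iff]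
  refine and_congr_right fun hμ => forall₃_congr fun p hp hp1 => ?_
  constructor
  · rintro ⟨ν, hν⟩
    exact ⟨ν, hν.carriedBy hp hI hμ, hν.isThinning hp hp1.le⟩
  · rintro ⟨ν, -, hν⟩
    exact ⟨ν, hν.isGeomSum hp hp1.le⟩

/-! ### Geometric sums starting from 0 -/

lemma charFun_add_smul_dirac (q r : ℝ) (hq : 0 ≤ q) (hr : 0 ≤ r) (G : ProbabilityMeasure ℝ)
    (t : ℝ) :
    charFun (ENNReal.ofReal q • Measure.dirac (0 : ℝ) + ENNReal.ofReal r • (G : Measure ℝ)) t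
      = q + r * charFun (G : Measure ℝ) t := by
  have hInt : ∀ m : Measure ℝ, IsFiniteMeasure m →
      Integrable (fun x : ℝ => Complex.exp (t * x * Complex.I)) m := fun m _ =>
    Integrable.of_bound (C := 1) (by fun_prop) (ae_of_all _ fun x => by
      rw [Complex.norm_exp]; simp)
  simp only [charFun_apply_real]
  rw [integral_add_measure ((hInt _ inferInstance).smul_measure ENNReal.ofReal_ne_top)
    ((hInt _ inferInstance).smul_measure ENNReal.ofReal_ne_top), integral_smul_measure,
    integral_smul_measure, integral_dirac, ENNReal.toReal_ofReal hq, ENNReal.toReal_ofReal hr]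
  simp

/-- Geometric sums with the number of summands starting from `0`. -/
lemma exists_charFun_eq_inv {c : ℝ} (hc : 0 ≤ c) (ν : ProbabilityMeasure ℝ) :
    ∃ ρ : ProbabilityMeasure ℝ, ∀ t,
      charFun (ρ : Measure ℝ) t = 1 / (1 + c * (1 - charFun (ν : Measure ℝ) t)) := by
  have hc1 : 0 < 1 + c := by linarith
  -- Zero summands with probability q, otherwise the geometric sum G: the transform is q / (1 - (1 -
  -- q) f), and 1 - q = q c.
  set q : ℝ := 1 / (1 + c) with hq
  have hq0 : 0 < q := by positivity
  have hq1 : q ≤ 1 := by rw [hq, div_le_one hc1]; linarith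
  obtain ⟨G, hG⟩ := exists_isGeomSum hq0 hq1 ν
  let m : Measure ℝ := ENNReal.ofReal q • Measure.dirac (0 : ℝ) +
    ENNReal.ofReal (1 - q) • (G : Measure ℝ)
  have hm : IsProbabilityMeasure m := ⟨by
    simp [m, ← ENNReal.ofReal_add hq0.le (sub_nonneg.2 hq1)]⟩
  refine ⟨⟨m, hm⟩, fun t => ?_⟩
  have h1 := hG.charFun_mul hq0 hq1 t
  have h2 := one_sub_mul_ne_zero hq0 hq1 (norm_charFun_le_one (μ := (ν : Measure ℝ)) t)
  have h3 : (q : ℂ) * (1 + c) = 1 := by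
    rw [hq]; push_cast
    exact one_div_mul_cancel (by exact_mod_cast hc1.ne')
  change charFun m t = _
  rw [charFun_add_smul_dirac q (1 - q) hq0.le (sub_nonneg.2 hq1)]
  set f := charFun (ν : Measure ℝ) t
  set a := charFun (G : Measure ℝ) t
  have h4 : (q : ℂ) * (1 + c * (1 - f)) = 1 - (1 - q) * f := by linear_combination (1 - f) * h3
  have h5 : (1 : ℂ) + c * (1 - f) ≠ 0 := fun h => h2 (by rw [← h4, h, mul_zero])
  rw [eq_div_iff h5]
  have hq' : (q : ℂ) ≠ 0 := by exact_mod_cast hq0.ne'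
  refine mul_left_cancel₀ hq' ?_
  push_cast
  linear_combination ((q : ℂ) + (1 - q) * a) * h4 + (1 - q) * h1

lemma one_le_re_one_add {c : ℝ} (hc : 0 ≤ c) (ν : ProbabilityMeasure ℝ) (t : ℝ) :
    1 ≤ (1 + c * (1 - charFun (ν : Measure ℝ) t)).re := by
  rw [Complex.add_re, Complex.re_ofReal_mul, Complex.sub_re, Complex.one_re]
  have := mul_nonneg hc (sub_nonneg.2 (re_charFun_le_one ν t))
  linarith

lemma ne_zero_of_one_le_re {w : ℂ} (h : 1 ≤ w.re) : w ≠ 0 := fun h0 => by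
  rw [h0, Complex.zero_re] at h
  linarith

/-- Limits of laws of geometric sums starting from `0` are geometrically infinitely divisible. -/
lemma isGID_of_tendsto_inv {c : ℕ → ℝ} (hc : ∀ n, 0 ≤ c n) {f : ℕ → ProbabilityMeasure ℝ}
    {μ : ProbabilityMeasure ℝ}
    (h : ∀ t, Tendsto (fun n => 1 / (1 + c n * (1 - charFun (f n : Measure ℝ) t))) atTop
      (𝓝 (charFun (μ : Measure ℝ) t))) : IsGID μ := by
  intro p hp hp1
  -- Passing to the summands multiplies 1/g - 1 by p, that is, replaces c n by p * c n.
  choose ν hν using fun n => exists_charFun_eq_inv (mul_nonneg hp.le (hc n)) (f n)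
  refine exists_isGeomSum_of_tendsto hp hp1.le (ν := ν) (fun n t => ?_) h fun t => ?_
  · have h1 := ne_zero_of_one_le_re (one_le_re_one_add (hc n) (f n) t)
    have h2 := ne_zero_of_one_le_re (one_le_re_one_add (mul_nonneg hp.le (hc n)) (f n) t)
    rw [hν n t, ← mul_div_assoc, mul_one, div_mul_eq_mul_div, one_mul, div_eq_iff h2,
      div_mul_eq_mul_div, one_mul, eq_div_iff h1, add_mul, div_mul_cancel₀ _ h1]
    push_cast
    ring
  · refine ge_of_tendsto' ((Complex.continuous_re.tendsto _).comp (h t)) fun n => ?_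
    rw [Function.comp_apply, one_div, Complex.inv_re]
    exact div_nonneg (zero_le_one.trans (one_le_re_one_add (hc n) (f n) t))
      (Complex.normSq_nonneg _)

/-- The weights are normalised to a probability measure; an empty sum is covered by c = 0. -/
lemma exists_charFun_eq_sum {k : ℕ} (l β : Fin k → ℝ) (hl : ∀ j, 0 < l j) :
    ∃ (c : ℝ) (ν : ProbabilityMeasure ℝ), 0 ≤ c ∧ ∀ t : ℝ,
      ∑ j, (l j : ℂ) * (1 - Complex.exp (Complex.I * β j * t))
        = c * (1 - charFun (ν : Measure ℝ) t) := by
  rcases k.eq_zero_or_pos with rfl | hk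
  · exact ⟨0, ⟨Measure.dirac 0, inferInstance⟩, le_rfl, fun t => by simp⟩
  have : Nonempty (Fin k) := ⟨⟨0, hk⟩⟩
  set c := ∑ j, l j with hc
  have hc0 : 0 < c := Finset.sum_pos (fun j _ => hl j) Finset.univ_nonempty
  let m : Measure ℝ := ∑ j, ENNReal.ofReal (l j / c) • Measure.dirac (β j)
  have hm : IsProbabilityMeasure m := ⟨by
    simp only [m, Measure.coe_finsetSum, Finset.sum_apply, Measure.smul_apply, measure_univ,
      smul_eq_mul, mul_one]
    rw [← ENNReal.ofReal_sum_of_nonneg fun j _ => (div_pos (hl j) hc0).le, ← Finset.sum_div,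
      ← hc, div_self hc0.ne', ENNReal.ofReal_one]⟩
  refine ⟨c, ⟨m, hm⟩, hc0.le, fun t => ?_⟩
  have h1 : charFun m t = ∑ j, ((l j / c : ℝ) : ℂ) * Complex.exp (Complex.I * β j * t) := by
    rw [charFun_apply_real, integral_finsetSum_measure fun j _ =>
      (integrable_dirac (by simp)).smul_measure ENNReal.ofReal_ne_top]
    refine Finset.sum_congr rfl fun j _ => ?_
    rw [integral_smul_measure, integral_dirac, ENNReal.toReal_ofReal (div_pos (hl j) hc0).le,
      Complex.real_smul]
    ring_nf
  change _ = c * (1 - charFun m t)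
  have hc' : (c : ℂ) ≠ 0 := by exact_mod_cast hc0.ne'
  rw [h1, mul_sub, mul_one, Finset.mul_sum]
  simp only [mul_sub, mul_one, Finset.sum_sub_distrib]
  congr 1
  · rw [hc]; push_cast; rfl
  · refine Finset.sum_congr rfl fun j _ => ?_
    push_cast
    field_simp

/-! ### Geometric sums of negligible summands -/

/-- Bound |1 - exp(itx)| by |tx| where |x| ≤ ε and by 2 elsewhere. -/
lemma norm_one_sub_charFun_le (ν : ProbabilityMeasure ℝ) (t : ℝ) {ε : ℝ} (hε : 0 ≤ ε) :
    ‖1 - charFun (ν : Measure ℝ) t‖ ≤ ε * |t| + 2 * (ν : Measure ℝ).real {x | ε < |x|} := by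
  have hS : MeasurableSet {x : ℝ | ε < |x|} := measurableSet_lt measurable_const (by fun_prop)
  have hInt : Integrable (fun x : ℝ => Complex.exp (t * x * Complex.I)) (ν : Measure ℝ) :=
    Integrable.of_bound (C := 1) (by fun_prop) (ae_of_all _ fun x => by
      rw [Complex.norm_exp]; simp)
  have h1 : 1 - charFun (ν : Measure ℝ) t
      = ∫ x : ℝ, (1 - Complex.exp (t * x * Complex.I)) ∂(ν : Measure ℝ) := by
    rw [integral_sub (integrable_const _) hInt, charFun_apply_real]
    simp
  have h2 : ∫ x : ℝ, (ε * |t| + {x : ℝ | ε < |x|}.indicator (fun _ => (2 : ℝ)) x) ∂(ν : Measure ℝ)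
      = ε * |t| + 2 * (ν : Measure ℝ).real {x | ε < |x|} := by
    rw [integral_add (integrable_const _) ((integrable_const _).indicator hS),
      integral_indicator_const _ hS]
    simp [mul_comm]
  rw [h1, ← h2]
  refine norm_integral_le_of_norm_le
    ((integrable_const _).add ((integrable_const _).indicator hS)) (ae_of_all _ fun x => ?_)
  by_cases hx : ε < |x|
  · simp only [Set.indicator, Set.mem_ofPred_eq, hx, if_true]
    have : ‖(1 : ℂ) - Complex.exp (t * x * Complex.I)‖ ≤ 1 + 1 :=
      (norm_sub_le _ _).trans (by rw [Complex.norm_exp]; simp)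
    have := mul_nonneg hε (abs_nonneg t)
    linarith
  · simp only [Set.indicator, Set.mem_ofPred_eq, hx, if_false, add_zero]
    have h3 := Real.norm_exp_I_mul_ofReal_sub_one_le (x := t * x)
    rw [norm_sub_rev] at h3
    push_cast at h3
    rw [mul_comm Complex.I] at h3
    refine h3.trans ?_
    rw [norm_mul, mul_comm]
    exact mul_le_mul_of_nonneg_right (not_lt.1 hx) (abs_nonneg t)

lemma tendsto_charFun_of_negligible {ν : ℕ → ProbabilityMeasure ℝ}
    (h : ∀ ε : ℝ, 0 < ε → Tendsto (fun n => (ν n : Measure ℝ) {x | ε < |x|}) atTop (𝓝 0)) (t : ℝ) :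
    Tendsto (fun n => charFun (ν n : Measure ℝ) t) atTop (𝓝 1) := by
  rw [tendsto_iff_norm_sub_tendsto_zero, Metric.tendsto_atTop]
  intro δ hδ
  set ε : ℝ := δ / (2 * (|t| + 1)) with hε
  have hε0 : 0 < ε := by positivity
  have h1 : Tendsto (fun n => (ν n : Measure ℝ).real {x | ε < |x|}) atTop (𝓝 0) := by
    have := (ENNReal.tendsto_toReal ENNReal.zero_ne_top).comp (h ε hε0)
    rwa [ENNReal.toReal_zero] at this
  obtain ⟨n₀, hn₀⟩ := (Metric.tendsto_atTop.1 h1) (δ / 4) (by positivity)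
  refine ⟨n₀, fun n hn => ?_⟩
  have h2 := hn₀ n hn
  rw [Real.dist_0_eq_abs, abs_of_nonneg measureReal_nonneg] at h2
  rw [Real.dist_0_eq_abs, abs_of_nonneg (norm_nonneg _), norm_sub_rev]
  have h3 : ε * |t| ≤ δ / 2 := by
    rw [hε, div_mul_eq_mul_div, div_le_div_iff₀ (by positivity) two_pos]
    nlinarith [abs_nonneg t]
  linarith [norm_one_sub_charFun_le (ν n) t hε0.le]

/-- Limits of geometric sums of negligible summands are geometrically infinitely divisible. -/
lemma isGID_of_tendsto_isGeomSum {ν η : ℕ → ProbabilityMeasure ℝ} {μ : ProbabilityMeasure ℝ}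
    (hν : ∀ ε : ℝ, 0 < ε → Tendsto (fun n => (ν n : Measure ℝ) {x | ε < |x|}) atTop (𝓝 0))
    (hη : ∀ n : ℕ, 1 ≤ n → IsGeomSum (1 / (n : ℝ)) (ν n) (η n))
    (hlim : Tendsto η atTop (𝓝 μ)) : IsGID μ := by
  rw [ProbabilityMeasure.tendsto_iff_tendsto_charFun] at hlim
  refine isGID_of_tendsto_inv (c := fun n => (n : ℝ)) (fun n => n.cast_nonneg) (f := ν) fun t => ?_
  have h0 : Tendsto (fun n => 2 * ‖1 - charFun (ν n : Measure ℝ) t‖) atTop (𝓝 0) := by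
    simpa using ((tendsto_charFun_of_negligible hν t).const_sub 1).norm.const_mul 2
  -- Starting the count at 1 rather than 0 is harmless in the limit: the difference is (a - 1)(1 -
  -- f) / (1 + n (1 - f)), of modulus at most 2 |1 - f|.
  have h1 : Tendsto (fun n => charFun (η n : Measure ℝ) t -
      1 / (1 + ((n : ℝ) : ℂ) * (1 - charFun (ν n : Measure ℝ) t))) atTop (𝓝 0) := by
    refine squeeze_zero_norm' ?_ h0
    filter_upwards [eventually_ge_atTop 1] with n hn
    have hn' : (0 : ℝ) < n := by exact_mod_cast hn
    have h2 := (hη n hn).charFun_mul (p := 1 / (n : ℝ)) (by positivity)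
      (by rw [div_le_one hn']; exact_mod_cast hn) t
    have h3 := one_le_re_one_add hn'.le (ν n) t
    have h4 := ne_zero_of_one_le_re h3
    have hn0 : ((n : ℝ) : ℂ) ≠ 0 := by exact_mod_cast hn'.ne'
    push_cast at h2 h3 h4 hn0 ⊢
    set f := charFun (ν n : Measure ℝ) t
    set a := charFun (η n : Measure ℝ) t
    have h5 : a - 1 / (1 + n * (1 - f)) = (a - 1) * (1 - f) / (1 + n * (1 - f)) := by
      rw [eq_div_iff h4, sub_mul, one_div_mul_cancel h4]
      field_simp at h2
      linear_combination h2
    rw [h5, norm_div, norm_mul]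
    have h6 : 1 ≤ ‖1 + (n : ℂ) * (1 - f)‖ := h3.trans (Complex.re_le_norm _)
    have h7 : ‖a - 1‖ ≤ 2 := by
      rw [norm_sub_rev]
      exact norm_one_sub_charFun_le_two
    exact (div_le_self (by positivity) h6).trans
      (mul_le_mul_of_nonneg_right h7 (norm_nonneg _))
  simpa using (hlim t).sub h1

/-! ### Approximation by finite exponential sums -/

/-- Finite exponential sums approximate characteristic functions uniformly on compact sets. -/
lemma exists_sum_approx {c : ℝ} (hc : 0 < c) (ν : ProbabilityMeasure ℝ) (T : ℝ) {δ : ℝ}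
    (hδ : 0 < δ) :
    ∃ (k : ℕ) (l β : Fin k → ℝ), (∀ j, 0 < l j) ∧ ∀ t : ℝ, |t| ≤ T →
      ‖c * (1 - charFun (ν : Measure ℝ) t) -
        ∑ j, (l j : ℂ) * (1 - Complex.exp (Complex.I * β j * t))‖ ≤ δ := by
  classical
  -- Two unimodular exponentials differ by at most 2, and by at most |T| |D n x - x| for |t| ≤ T.
  -- Both cases are covered by (2 + |T|) min(1, |D n x - x|); truncating at 1 avoids moment
  -- assumptions.
  set M : ℝ := c * (2 + |T|) with hM
  have hM0 : 0 < M := by positivity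
  let D : ℕ → SimpleFunc ℝ ℝ := SimpleFunc.approxOn id measurable_id Set.univ 0 (Set.mem_univ _)
  have hD : ∀ x, Tendsto (fun n => D n x) atTop (𝓝 x) := fun x =>
    SimpleFunc.tendsto_approxOn measurable_id (Set.mem_univ _) (by simp)
  have hD1 : Tendsto (fun n => ∫ x, min 1 |D n x - x| ∂(ν : Measure ℝ)) atTop (𝓝 0) := by
    have h := tendsto_integral_of_dominated_convergence (μ := (ν : Measure ℝ))
      (F := fun n x => min 1 |D n x - x|) (f := fun _ => 0) (fun _ => (1 : ℝ))
      (fun n => ((measurable_const.min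
        ((D n).measurable.sub measurable_id).norm)).aestronglyMeasurable)
      (integrable_const _) (fun n => ae_of_all _ fun x => by
        rw [Real.norm_of_nonneg (by positivity)]; exact min_le_left _ _)
      (ae_of_all _ fun x => by
        have := ((hD x).sub_const x).abs
        simpa using (tendsto_const_nhds (x := (1 : ℝ))).min this)
    simpa using h
  obtain ⟨n, hn⟩ := (hD1.eventually (gt_mem_nhds (div_pos hδ hM0))).exists
  set f := D n
  -- Values of zero mass are discarded because the weights must be strictly positive.
  let s : Finset ℝ := f.range.filter fun y => 0 < (ν : Measure ℝ).real (f ⁻¹' {y})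
  refine ⟨s.card, fun j => c * (ν : Measure ℝ).real (f ⁻¹' {(s.equivFin.symm j : ℝ)}),
    fun j => (s.equivFin.symm j : ℝ), fun j => mul_pos hc
      (Finset.mem_filter.1 (s.equivFin.symm j).2).2, fun t ht => ?_⟩
  have hInt : ∀ g : ℝ → ℝ, Measurable g →
      Integrable (fun x : ℝ => Complex.exp (Complex.I * g x * t)) (ν : Measure ℝ) := fun g hg =>
    Integrable.of_bound (C := 1) (by fun_prop) (ae_of_all _ fun x => by
      rw [Complex.norm_exp]; simp)
  have hsum : ∑ j : Fin s.card,
      ((c * (ν : Measure ℝ).real (f ⁻¹' {(s.equivFin.symm j : ℝ)}) : ℝ) : ℂ) *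
        (1 - Complex.exp (Complex.I * (s.equivFin.symm j : ℝ) * t))
      = c * ∫ x, (1 - Complex.exp (Complex.I * f x * t)) ∂(ν : Measure ℝ) := by
    rw [Equiv.sum_comp s.equivFin.symm (fun y : s =>
      ((c * (ν : Measure ℝ).real (f ⁻¹' {(y : ℝ)}) : ℝ) : ℂ)
        * (1 - Complex.exp (Complex.I * (y : ℝ) * t))),
      Finset.sum_coe_sort s (fun y : ℝ => ((c * (ν : Measure ℝ).real (f ⁻¹' {y}) : ℝ) : ℂ)
        * (1 - Complex.exp (Complex.I * y * t)))]
    have h1 := SimpleFunc.map_integral (μ := (ν : Measure ℝ)) f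
      (fun y : ℝ => 1 - Complex.exp (Complex.I * y * t))
      (SimpleFunc.integrable_of_isFiniteMeasure f) (by simp)
    rw [SimpleFunc.integral_eq_integral _ (SimpleFunc.integrable_of_isFiniteMeasure _)] at h1
    simp only [SimpleFunc.map_apply, Complex.real_smul] at h1
    rw [h1, Finset.mul_sum]
    rw [Finset.sum_filter_of_ne]
    · refine Finset.sum_congr rfl fun y _ => ?_
      push_cast
      ring
    · intro y _ hy
      refine lt_of_le_of_ne measureReal_nonneg fun h => hy ?_
      simp [← h]
  have hcf : 1 - charFun (ν : Measure ℝ) t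
      = ∫ x : ℝ, (1 - Complex.exp (Complex.I * (id x : ℝ) * t)) ∂(ν : Measure ℝ) := by
    rw [integral_sub (integrable_const _) (hInt id measurable_id), charFun_apply_real]
    simp only [integral_const, probReal_univ, one_smul, id]
    congr with x
    ring_nf
  have hInt' : ∀ g : ℝ → ℝ, Measurable g →
      Integrable (fun x : ℝ => 1 - Complex.exp (Complex.I * g x * t)) (ν : Measure ℝ) :=
    fun g hg => (integrable_const _).sub (hInt g hg)
  rw [hsum, hcf, ← mul_sub, ← integral_sub (hInt' id measurable_id) (hInt' f f.measurable),
    norm_mul, Complex.norm_real, Real.norm_of_nonneg hc.le]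
  have hbound : ‖∫ x : ℝ, ((1 - Complex.exp (Complex.I * (id x : ℝ) * t)) -
      (1 - Complex.exp (Complex.I * f x * t))) ∂(ν : Measure ℝ)‖
      ≤ ∫ x, (2 + |T|) * min 1 |f x - x| ∂(ν : Measure ℝ) := by
    refine norm_integral_le_of_norm_le (Integrable.const_mul (Integrable.of_bound (C := 1)
      ((measurable_const.min ((D n).measurable.sub measurable_id).norm)).aestronglyMeasurable
      (ae_of_all _ fun x => by
        rw [Real.norm_of_nonneg (by positivity)]; exact min_le_left _ _)) _)
      (ae_of_all _ fun x => ?_)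
    rw [sub_sub_sub_cancel_left, id]
    have hn1 : ∀ y : ℝ, ‖Complex.exp (Complex.I * y * t)‖ = 1 := fun y => by
      rw [Complex.norm_exp]; simp
    rcases le_total 1 |f x - x| with h | h
    · rw [min_eq_left h, mul_one]
      refine (norm_sub_le _ _).trans ?_
      rw [hn1, hn1]
      linarith [abs_nonneg T]
    · rw [min_eq_right h]
      have h2 : Complex.exp (Complex.I * f x * t) - Complex.exp (Complex.I * x * t)
          = Complex.exp (Complex.I * x * t) *
            (Complex.exp (Complex.I * ((f x - x) * t : ℝ)) - 1) := by
        rw [mul_sub, ← Complex.exp_add]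
        push_cast
        ring_nf
      rw [h2, norm_mul, hn1, one_mul]
      refine (Real.norm_exp_I_mul_ofReal_sub_one_le).trans ?_
      rw [norm_mul, mul_comm]
      refine mul_le_mul_of_nonneg_right ?_ (abs_nonneg _)
      rw [Real.norm_eq_abs]
      linarith [le_abs_self T]
  rw [integral_const_mul] at hbound
  calc c * _ ≤ c * ((2 + |T|) * ∫ x, min 1 |f x - x| ∂(ν : Measure ℝ)) :=
        mul_le_mul_of_nonneg_left hbound hc.le
    _ = M * ∫ x, min 1 |f x - x| ∂(ν : Measure ℝ) := by rw [hM, mul_assoc]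
    _ ≤ M * (δ / M) := mul_le_mul_of_nonneg_left hn.le hM0.le
    _ = δ := by field_simp

/-- The geometrically infinitely divisible distributions are those whose characteristic function
is a limit of functions `1 / (1 + ∑ λ (1 - exp (i β t)))`. -/
lemma gidClass_eq_charFunLimitClass (I : Set ℝ) : gidClass I = charFunLimitClass I := by
  ext μ
  rw [mem_gidClass_iff]
  refine and_congr_right fun _ => ⟨fun h => ?_, ?_⟩
  · obtain ⟨h0, h1, h2⟩ := parameter_seq
    choose ν hν using fun n : ℕ => h _ (h0 n) (h1 n)
    -- The factor n + 2 is the reciprocal of the parameter, and the window |t| ≤ n eventually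
    -- contains every t.
    choose k l β hl hlβ using fun n : ℕ => exists_sum_approx (c := (n : ℝ) + 2) (by positivity)
      (ν n) n (δ := 1 / ((n : ℝ) + 2)) (h0 n)
    refine ⟨k, l, β, hl, fun t => ?_⟩
    have hg := h.charFun_ne_zero t
    have h3 := tendsto_one_sub_charFun_div h0 (fun n => (h1 n).le) h2 hν hg
    have h4 : Tendsto (fun n : ℕ => (((n : ℝ) + 2 : ℝ) : ℂ) * (1 - charFun (ν n : Measure ℝ) t) -
        ∑ j, (l n j : ℂ) * (1 - Complex.exp (Complex.I * β n j * t))) atTop (𝓝 0) := by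
      refine squeeze_zero_norm' ?_ h2
      filter_upwards [tendsto_natCast_atTop_atTop.eventually_ge_atTop |t|] with n hn
      exact hlβ n t hn
    have h5 := (h3.sub h4).const_add 1
    rw [sub_zero, add_sub_cancel] at h5
    have h6 := (tendsto_const_nhds (x := (1 : ℂ))).div h5 (one_div_ne_zero hg)
    rw [one_div_one_div] at h6
    refine h6.congr fun n => ?_
    simp only [Pi.div_apply]
    congr 2
    have : (1 - charFun (ν n : Measure ℝ) t) / ((1 / ((n : ℝ) + 2) : ℝ) : ℂ)
        = (((n : ℝ) + 2 : ℝ) : ℂ) * (1 - charFun (ν n : Measure ℝ) t) := by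
      rw [Complex.ofReal_div, Complex.ofReal_one, div_div_eq_mul_div, div_one, mul_comm]
    rw [this, sub_sub_cancel]
  · rintro ⟨k, l, β, hl, hlim⟩
    choose c ν hc hcν using fun n => exists_charFun_eq_sum (l n) (β n) (hl n)
    refine isGID_of_tendsto_inv hc (f := ν) fun t => ?_
    simpa only [← hcν] using hlim t

/-! ### Laplace transforms and the laws with transform exp(-c θ) -/

lemma expTransform_neg_ofReal (s : ℝ) (ν : Measure ℝ) :
    expTransform (-(s : ℂ)) ν = ((∫ x, Real.exp (-(s * x)) ∂ν : ℝ) : ℂ) := by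
  rw [expTransform, ← integral_complex_ofReal]
  congr with x
  push_cast
  ring_nf

lemma norm_exp_neg_ofReal_le_one {s : ℝ} (hs : 0 ≤ s) {ν : ProbabilityMeasure ℝ}
    (hν : CarriedBy (Set.Ici 0) ν) :
    ∀ᵐ x : ℝ ∂(ν : Measure ℝ), ‖Complex.exp (-(s : ℂ) * x)‖ ≤ 1 := by
  filter_upwards [hν] with x hx
  rw [Complex.norm_exp]
  simpa using mul_nonneg hs hx

lemma integrable_exp_neg {s : ℝ} (hs : 0 ≤ s) {ν : ProbabilityMeasure ℝ}
    (hν : CarriedBy (Set.Ici 0) ν) :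
    Integrable (fun x => Real.exp (-(s * x))) (ν : Measure ℝ) := by
  refine Integrable.of_bound (C := 1) (by fun_prop) ?_
  filter_upwards [hν] with x hx
  rw [Real.norm_of_nonneg (Real.exp_pos _).le, Real.exp_le_one_iff]
  simpa using mul_nonneg hs hx

lemma integral_exp_neg_pos {s : ℝ} (hs : 0 ≤ s) {ν : ProbabilityMeasure ℝ}
    (hν : CarriedBy (Set.Ici 0) ν) : 0 < ∫ x, Real.exp (-(s * x)) ∂(ν : Measure ℝ) :=
  integral_exp_pos (integrable_exp_neg hs hν)

/-- Convolution powers. -/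
lemma exists_expTransform_eq_pow (ν : ProbabilityMeasure ℝ) (k : ℕ) :
    ∃ ρ : ProbabilityMeasure ℝ, (∀ z, expTransform z ρ = expTransform z ν ^ k) ∧
      (CarriedBy (Set.Ici 0) ν → CarriedBy (Set.Ici 0) ρ) := by
  -- Only the i.i.d. sequence behind the geometric sum is used.
  obtain ⟨_, Ω, _, P, X, N, hP, hX, hl, hi, -⟩ := exists_isGeomSum one_pos le_rfl ν
  have hm : Measurable fun ω => ∑ j ∈ Finset.range k, X j ω :=
    Finset.measurable_fun_sum _ fun j _ => hX j
  refine ⟨⟨P.map fun ω => ∑ j ∈ Finset.range k, X j ω,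
    Measure.isProbabilityMeasure_map hm.aemeasurable⟩, fun z => ?_, fun h => ?_⟩
  · rw [← expTransform_sum_range hX hl hi, expTransform]
    exact integral_map hm.aemeasurable (by fun_prop)
  · refine (ae_map_iff hm.aemeasurable measurableSet_Ici).2 ?_
    have h1 : ∀ᵐ ω ∂P, ∀ j, X j ω ∈ Set.Ici 0 := ae_all_iff.2 fun j =>
      ae_of_ae_map (hX j).aemeasurable ((hl j).map_eq ▸ h)
    filter_upwards [h1] with ω hω
    exact Finset.sum_nonneg fun j _ => hω j

lemma tendsto_pow_add_two_exp {h : ℕ → ℂ} {c : ℂ}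
    (hh : Tendsto (fun m : ℕ => ((m : ℂ) + 2) * (h m - 1)) atTop (𝓝 c)) :
    Tendsto (fun m => h m ^ (m + 2)) atTop (𝓝 (Complex.exp c)) := by
  have h1 : Tendsto (fun n : ℕ => (n : ℂ) * (h (n - 2) - 1)) atTop (𝓝 c) := by
    rw [← tendsto_add_atTop_iff_nat 2]
    simpa using hh
  have h2 := Complex.tendsto_one_add_pow_exp_of_tendsto h1
  rw [← tendsto_add_atTop_iff_nat 2] at h2
  simpa using h2

lemma carriedBy_of_tendsto {ρ : ℕ → ProbabilityMeasure ℝ} {ρ₀ : ProbabilityMeasure ℝ}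
    (h : ∀ m, CarriedBy (Set.Ici 0) (ρ m)) (hlim : Tendsto ρ atTop (𝓝 ρ₀)) :
    CarriedBy (Set.Ici 0) ρ₀ := by
  have h1 := ProbabilityMeasure.le_liminf_measure_open_of_tendsto hlim (isOpen_Iio (a := (0 : ℝ)))
  have h2 : ∀ m, (ρ m : Measure ℝ) (Set.Iio 0) = 0 := fun m => by
    have := h m
    rw [CarriedBy, ae_iff] at this
    simpa [Set.Iio] using this
  simp only [h2, liminf_const, nonpos_iff_eq_zero] at h1
  rw [CarriedBy, ae_iff]
  simpa [Set.Iio] using h1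

/-- Replacing x by max(x, 0) makes the integrand bounded and continuous on the whole line without
changing it on the supports. -/
lemma tendsto_integral_exp_neg {s : ℝ} (hs : 0 ≤ s) {ρ : ℕ → ProbabilityMeasure ℝ}
    {ρ₀ : ProbabilityMeasure ℝ} (h : ∀ m, CarriedBy (Set.Ici 0) (ρ m))
    (hlim : Tendsto ρ atTop (𝓝 ρ₀)) :
    Tendsto (fun m => ∫ x, Real.exp (-(s * x)) ∂(ρ m : Measure ℝ)) atTop
      (𝓝 (∫ x, Real.exp (-(s * x)) ∂(ρ₀ : Measure ℝ))) := by
  have h1 := (ProbabilityMeasure.tendsto_iff_forall_integral_tendsto.1 hlim)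
    (BoundedContinuousFunction.ofNormedAddCommGroup (fun x => Real.exp (-(s * max x 0)))
      (by fun_prop) 1 fun x => by
        rw [Real.norm_of_nonneg (Real.exp_pos _).le, Real.exp_le_one_iff]
        simpa using mul_nonneg hs (le_max_right x 0))
  have h2 : ∀ ν : ProbabilityMeasure ℝ, CarriedBy (Set.Ici 0) ν →
      ∫ x, Real.exp (-(s * max x 0)) ∂(ν : Measure ℝ) = ∫ x, Real.exp (-(s * x)) ∂(ν : Measure ℝ) :=
    fun ν hν => integral_congr_ae (by
      filter_upwards [hν] with x hx
      rw [max_eq_left hx])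
  simp only [BoundedContinuousFunction.coe_ofNormedAddCommGroup] at h1
  rw [h2 ρ₀ (carriedBy_of_tendsto h hlim)] at h1
  exact h1.congr fun m => h2 _ (h m)

/-- If `1 / (1 + θ)` is the transform of a geometrically infinitely divisible distribution on
`[0, ∞)`, then `exp (-c θ)` is the transform of a distribution on `[0, ∞)`. -/
lemma IsGID.exists_charFun_eq_exp {μ : ProbabilityMeasure ℝ} (hμ : IsGID μ)
    (hμ0 : CarriedBy (Set.Ici 0) μ) {c : ℝ} (hc : 0 < c) (hc1 : c ≤ 1) :
    ∃ ρ : ProbabilityMeasure ℝ, CarriedBy (Set.Ici 0) ρ ∧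
      (∀ t, charFun (ρ : Measure ℝ) t
        = Complex.exp (-(c * (1 / charFun (μ : Measure ℝ) t - 1)))) ∧
      ∀ s : ℝ, 0 ≤ s → ∫ x, Real.exp (-(s * x)) ∂(ρ : Measure ℝ)
        = Real.exp (-(c * (1 / ∫ x, Real.exp (-(s * x)) ∂(μ : Measure ℝ) - 1))) := by
  obtain ⟨h0, h1, h2⟩ := parameter_seq
  have hp0 : ∀ m : ℕ, 0 < c * (1 / ((m : ℝ) + 2)) := fun m => mul_pos hc (h0 m)
  have hp1 : ∀ m : ℕ, c * (1 / ((m : ℝ) + 2)) < 1 := fun m =>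
    (mul_le_of_le_one_left (h0 m).le hc1).trans_lt (h1 m)
  have hp2 : Tendsto (fun m : ℕ => c * (1 / ((m : ℝ) + 2))) atTop (𝓝 0) := by
    simpa using h2.const_mul c
  choose ν hν using fun m : ℕ => hμ _ (hp0 m) (hp1 m)
  have hν0 : ∀ m, CarriedBy (Set.Ici 0) (ν m) := fun m =>
    (hν m).carriedBy (hp0 m) measurableSet_Ici hμ0
  choose ρ hρ hρ0 using fun m : ℕ => exists_expTransform_eq_pow (ν m) (m + 2)
  -- For parameter c / (m + 2) the summand transform h satisfies (m + 2)(h - 1) → -c θ, so the (m +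
  -- 2)-fold convolutions converge. Imaginary z yields the weak limit, negative real z its Laplace
  -- transform.
  have key : ∀ z : ℂ, expTransform z μ ≠ 0 →
      (∀ m, ∀ᵐ x : ℝ ∂(ν m : Measure ℝ), ‖Complex.exp (z * x)‖ ≤ 1) →
      Tendsto (fun m => expTransform z (ρ m)) atTop
        (𝓝 (Complex.exp (-(c * (1 / expTransform z μ - 1))))) := fun z hz hz1 => by
    simp only [hρ]
    refine tendsto_pow_add_two_exp ?_
    have h3 := tendsto_one_sub_div hp0 hp2 hz fun m =>
      (hν m).expTransform_mul (hp0 m) (hp1 m).le (hz1 m)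
    refine (h3.const_mul (c : ℂ)).neg.congr fun m => ?_
    have hc' : (c : ℂ) ≠ 0 := by exact_mod_cast hc.ne'
    have hm : ((m : ℂ) + 2) ≠ 0 := by exact_mod_cast (by positivity : ((m : ℝ) + 2) ≠ 0)
    push_cast
    field_simp
    ring
  have hcont : Continuous (charFun (μ : Measure ℝ)) := continuous_charFun
  obtain ⟨ρ₀, h3, h4⟩ := exists_tendsto_of_tendsto_charFun (μ := ρ)
    (f := fun t => Complex.exp (-(c * (1 / charFun (μ : Measure ℝ) t - 1))))
    (Complex.continuous_exp.comp ((((continuous_const.div hcont hμ.charFun_ne_zero).sub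
      continuous_const).const_mul _).neg)).continuousAt fun t => by
      have := key (t * Complex.I) (by rw [expTransform_mul_I]; exact hμ.charFun_ne_zero t)
        fun m => ae_of_all _ (norm_exp_mul_I_le_one t)
      simpa only [expTransform_mul_I] using this
  have h5 := fun m => hρ0 m (hν0 m)
  refine ⟨ρ₀, carriedBy_of_tendsto h5 h4, h3, fun s hs => ?_⟩
  have h6 := key (-(s : ℂ)) (by
    rw [expTransform_neg_ofReal]
    exact_mod_cast (integral_exp_neg_pos hs hμ0).ne') fun m =>
      norm_exp_neg_ofReal_le_one hs (hν0 m)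
  simp only [expTransform_neg_ofReal] at h6
  have h7 := (Complex.continuous_ofReal.tendsto _).comp (tendsto_integral_exp_neg hs h5 h4)
  have h8 := tendsto_nhds_unique h7 h6
  exact_mod_cast h8

lemma tendsto_integral_exp_neg_atTop {μ : ProbabilityMeasure ℝ} (hμ : CarriedBy (Set.Ioi 0) μ) :
    Tendsto (fun k : ℕ => ∫ x, Real.exp (-(k * x)) ∂(μ : Measure ℝ)) atTop (𝓝 0) := by
  have h := tendsto_integral_of_dominated_convergence (μ := (μ : Measure ℝ))
    (F := fun (k : ℕ) x => Real.exp (-(k * x))) (f := fun _ => 0) (fun _ => (1 : ℝ))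
    (fun k => by fun_prop) (integrable_const _) (fun k => by
      filter_upwards [hμ] with x hx
      rw [Real.norm_of_nonneg (Real.exp_pos _).le, Real.exp_le_one_iff]
      simpa using mul_nonneg k.cast_nonneg (le_of_lt hx))
    (by
      filter_upwards [hμ] with x hx
      exact Real.tendsto_exp_neg_atTop_nhds_zero.comp
        (tendsto_natCast_atTop_atTop.atTop_mul_const hx))
  simpa using h

/-- As s → ∞ the Laplace transform of μ tends to 0, so its reciprocal diverges and the transform of
ρ tends to 0; the latter dominates the mass of ρ at 0. -/
lemma carriedBy_Ioi_of_integral_exp_neg {μ ρ : ProbabilityMeasure ℝ}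
    (hμ : CarriedBy (Set.Ioi 0) μ) (hρ0 : CarriedBy (Set.Ici 0) ρ) {c : ℝ} (hc : 0 < c)
    (hρ : ∀ s : ℝ, 0 ≤ s → ∫ x, Real.exp (-(s * x)) ∂(ρ : Measure ℝ)
        = Real.exp (-(c * (1 / ∫ x, Real.exp (-(s * x)) ∂(μ : Measure ℝ) - 1)))) :
    CarriedBy (Set.Ioi 0) ρ := by
  have hμ0 : CarriedBy (Set.Ici 0) μ := hμ.mono fun _ hx => Set.mem_Ici.2 (le_of_lt hx)
  have h1 : Tendsto (fun k : ℕ => 1 / ∫ x, Real.exp (-(k * x)) ∂(μ : Measure ℝ)) atTop atTop := by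
    simp only [one_div]
    refine Tendsto.inv_tendsto_nhdsGT_zero (tendsto_nhdsWithin_iff.2
      ⟨tendsto_integral_exp_neg_atTop hμ, Eventually.of_forall fun k => ?_⟩)
    exact integral_exp_neg_pos k.cast_nonneg hμ0
  have h2 : Tendsto (fun k : ℕ => ∫ x, Real.exp (-(k * x)) ∂(ρ : Measure ℝ)) atTop (𝓝 0) := by
    refine (Real.tendsto_exp_neg_atTop_nhds_zero.comp ((tendsto_atTop_add_const_right _ (-1)
      h1).const_mul_atTop hc)).congr fun k => ?_
    rw [hρ k k.cast_nonneg]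
    rfl
  have h3 : (ρ : Measure ℝ).real {0} ≤ 0 := by
    refine ge_of_tendsto' h2 fun k => ?_
    have h4 : ∫ x, ({0} : Set ℝ).indicator (fun _ => (1 : ℝ)) x ∂(ρ : Measure ℝ)
        = (ρ : Measure ℝ).real {0} := by
      rw [integral_indicator_const _ (measurableSet_singleton _)]
      simp
    rw [← h4]
    refine integral_mono ((integrable_const _).indicator (measurableSet_singleton _))
      (integrable_exp_neg k.cast_nonneg hρ0) fun x => ?_
    by_cases hx : x = 0
    · simp [hx]
    · simp [hx, (Real.exp_pos _).le]
  have h5 : (ρ : Measure ℝ) {0} = 0 := by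
    have := le_antisymm h3 measureReal_nonneg
    rwa [measureReal_eq_zero_iff] at this
  have h6 : ∀ᵐ x ∂(ρ : Measure ℝ), x ≠ 0 := by
    rw [ae_iff]
    simpa using h5
  filter_upwards [hρ0, h6] with x hx hx0
  exact lt_of_le_of_ne hx (Ne.symm hx0)

lemma tendsto_measure_of_tendsto_charFun_one {ν : ℕ → ProbabilityMeasure ℝ}
    (h : ∀ t, Tendsto (fun n => charFun (ν n : Measure ℝ) t) atTop (𝓝 1)) {ε : ℝ} (hε : 0 < ε) :
    Tendsto (fun n => (ν n : Measure ℝ) {x | ε < |x|}) atTop (𝓝 0) := by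
  let δ : ProbabilityMeasure ℝ := ⟨Measure.dirac 0, inferInstance⟩
  have h1 : Tendsto ν atTop (𝓝 δ) := ProbabilityMeasure.tendsto_of_tendsto_charFun fun t => by
    have : charFun (δ : Measure ℝ) t = 1 := by
      change charFun (Measure.dirac (0 : ℝ)) t = 1
      simp
    rw [this]
    exact h t
  have h2 : (δ : Measure ℝ) (frontier {x | ε < |x|}) = 0 := by
    refine measure_mono_null (frontier_lt_subset_eq continuous_const continuous_abs) ?_
    change Measure.dirac (0 : ℝ) {x | ε = |x|} = 0
    rw [Measure.dirac_apply' _ (measurableSet_eq_fun measurable_const (by fun_prop))]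
    simp [hε.ne']
  have h3 := ProbabilityMeasure.tendsto_measure_of_null_frontier_of_tendsto' h1 h2
  have h4 : (δ : Measure ℝ) {x | ε < |x|} = 0 := by
    change Measure.dirac (0 : ℝ) {x | ε < |x|} = 0
    rw [Measure.dirac_apply' _ (measurableSet_lt measurable_const (by fun_prop))]
    simp [hε.le]
  rwa [h4] at h3

lemma tendsto_nat_mul_exp_div_sub_one (z : ℂ) :
    Tendsto (fun n : ℕ => (n : ℂ) * (Complex.exp (z / n) - 1)) atTop (𝓝 z) := by
  have h1 : HasDerivAt (fun u : ℂ => Complex.exp (u * z)) z 0 := by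
    simpa using ((hasDerivAt_id (0 : ℂ)).mul_const z).cexp
  have h2 : Tendsto (fun n : ℕ => ((n : ℂ))⁻¹) atTop (𝓝[≠] 0) := by
    refine tendsto_nhdsWithin_iff.2 ⟨tendsto_inv_atTop_nhds_zero_nat, ?_⟩
    filter_upwards [eventually_ge_atTop 1] with n hn
    exact inv_ne_zero (by exact_mod_cast (by omega : n ≠ 0))
  refine (h1.tendsto_slope_zero.comp h2).congr fun n => ?_
  simp [div_eq_inv_mul]

/-! ### Limits of geometric sums with Laplace transforms exp(-ψ/n) -/

/-- The geometrically infinitely divisible distributions on `I` are the limits of geometric sums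
of negligible summands with Laplace transforms `exp (-ψ / n)`. -/
lemma gidClass_eq_geomLimitClass {I : Set ℝ} (hI : I = Set.Ici 0 ∨ I = Set.Ioi 0) :
    gidClass I = geomLimitClass I := by
  ext μ
  rw [mem_gidClass_iff]
  refine and_congr_right fun hμI => ⟨fun h => ?_, ?_⟩
  · have hμ0 : CarriedBy (Set.Ici 0) μ := by
      rcases hI with rfl | rfl
      · exact hμI
      · exact hμI.mono fun _ hx => Set.mem_Ici.2 (le_of_lt hx)
    have hpar : ∀ n : ℕ, 1 ≤ n → (0 : ℝ) < 1 / n ∧ 1 / (n : ℝ) ≤ 1 := fun n hn => by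
      have hn' : (1 : ℝ) ≤ n := by exact_mod_cast hn
      exact ⟨by positivity, by rwa [div_le_one (by linarith)]⟩
    have hex : ∀ n : ℕ, ∃ ρ : ProbabilityMeasure ℝ, 1 ≤ n → CarriedBy I ρ ∧
        (∀ t, charFun (ρ : Measure ℝ) t
          = Complex.exp (-(((1 / (n : ℝ) : ℝ) : ℂ) * (1 / charFun (μ : Measure ℝ) t - 1)))) ∧
        ∀ s : ℝ, 0 ≤ s → ∫ x, Real.exp (-(s * x)) ∂(ρ : Measure ℝ)
          = Real.exp (-((1 / (n : ℝ)) * (1 / ∫ x, Real.exp (-(s * x)) ∂(μ : Measure ℝ) - 1))) := by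
      intro n
      by_cases hn : 1 ≤ n
      · obtain ⟨ρ, h1, h2, h3⟩ := h.exists_charFun_eq_exp hμ0 (hpar n hn).1 (hpar n hn).2
        refine ⟨ρ, fun _ => ⟨?_, h2, h3⟩⟩
        rcases hI with rfl | rfl
        · exact h1
        · exact carriedBy_Ioi_of_integral_exp_neg hμI h1 (hpar n hn).1 h3
      -- The row n = 0 is unconstrained; μ is a filler.
      · exact ⟨μ, fun h => absurd h hn⟩
    choose ν hν using hex
    have hex' : ∀ n : ℕ, ∃ η, 1 ≤ n → IsGeomSum (1 / (n : ℝ)) (ν n) η := fun n => by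
      by_cases hn : 1 ≤ n
      · obtain ⟨η, hη⟩ := exists_isGeomSum (hpar n hn).1 (hpar n hn).2 (ν n)
        exact ⟨η, fun _ => hη⟩
      · exact ⟨μ, fun h => absurd h hn⟩
    choose η hη using hex'
    -- The function ψ is 1/L - 1 for the Laplace transform L of μ.
    refine ⟨fun s => 1 / ∫ x, Real.exp (-(s * x)) ∂(μ : Measure ℝ) - 1, ν, η,
      fun n hn => (hν n hn).1, fun n hn => (hν n hn).2.2, fun ε hε => ?_, hη, ?_⟩
    · refine tendsto_measure_of_tendsto_charFun_one (fun t => ?_) hε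
      have h1 : Tendsto (fun n : ℕ => Complex.exp (-(((1 / (n : ℝ) : ℝ) : ℂ) *
          (1 / charFun (μ : Measure ℝ) t - 1)))) atTop (𝓝 1) := by
        have h2 : Tendsto (fun n : ℕ => ((1 / (n : ℝ) : ℝ) : ℂ)) atTop (𝓝 0) :=
          (Complex.continuous_ofReal.tendsto 0).comp tendsto_one_div_atTop_nhds_zero_nat
        have h3 := (h2.mul_const (1 / charFun (μ : Measure ℝ) t - 1)).neg.cexp
        simpa only [zero_mul, neg_zero, Complex.exp_zero] using h3
      refine h1.congr' ?_
      filter_upwards [eventually_ge_atTop 1] with n hn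
      exact ((hν n hn).2.1 t).symm
    · refine ProbabilityMeasure.tendsto_of_tendsto_charFun fun t => ?_
      have hg := h.charFun_ne_zero t
      -- For summands exp(-θ/n) and parameter 1/n the relation reads 1/g_n = 1 + n (exp(θ/n) - 1),
      -- which tends to 1 + θ = 1/g.
      have h1 := (tendsto_nat_mul_exp_div_sub_one
        (1 / charFun (μ : Measure ℝ) t - 1)).const_add 1
      rw [add_sub_cancel] at h1
      have h2 := (tendsto_const_nhds (x := (1 : ℂ))).div h1 (one_div_ne_zero hg)
      rw [one_div_one_div] at h2
      refine h2.congr' ?_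
      filter_upwards [eventually_ge_atTop 1, h1.eventually_ne (one_div_ne_zero hg)] with n hn hne
      have h3 := (hη n hn).charFun_mul (hpar n hn).1 (hpar n hn).2 t
      rw [(hν n hn).2.1 t] at h3
      simp only [Pi.div_apply]
      rw [div_eq_iff hne]
      have hn0 : (n : ℂ) ≠ 0 := by exact_mod_cast (by omega : n ≠ 0)
      set θ := 1 / charFun (μ : Measure ℝ) t - 1
      have h4 : Complex.exp (θ / n) * Complex.exp (-(((1 / (n : ℝ) : ℝ) : ℂ) * θ)) = 1 := by
        rw [← Complex.exp_add, Complex.exp_eq_one_iff]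
        refine ⟨0, ?_⟩
        push_cast
        ring
      set f := Complex.exp (-(((1 / (n : ℝ) : ℝ) : ℂ) * θ))
      set a := charFun (η n : Measure ℝ) t
      set e := Complex.exp (θ / n)
      push_cast at h3
      field_simp at h3
      linear_combination (-e) * h3 - (a * n - a + 1) * h4
  · rintro ⟨ψ, ν, η, -, -, h1, h2, h3⟩
    exact isGID_of_tendsto_isGeomSum h1 h2 h3

end GeomInfDiv

theorem theorem4p3 (I : Set ℝ) (hI : I = Set.Ici 0 ∨ I = Set.Ioi 0) :
    GeomInfDiv.gidClass I = GeomInfDiv.charFunLimitClass I ∧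
    GeomInfDiv.gidClass I = GeomInfDiv.geomLimitClass I ∧
    GeomInfDiv.gidClass I = GeomInfDiv.coxRenewalClass I :=
  ⟨GeomInfDiv.gidClass_eq_charFunLimitClass I, GeomInfDiv.gidClass_eq_geomLimitClass hI,
    GeomInfDiv.gidClass_eq_coxRenewalClass (by
      rcases hI with rfl | rfl
      exacts [measurableSet_Ici, measurableSet_Ioi])⟩
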